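/- Let $\Omega\subseteq\mathbb C$ be a non-empty open connected set and let $\mathcal H_0,\mathcal H_1$ be complex Hilbert spaces. For a bounded operator $T$ on a complex Hilbert space $\mathcal H$ and $n\ge 1$, write $T\in B_n(\Omega)$ if $\Omega\subseteq\sigma(T)$ and, for every $w\in\Omega$, $\dim\ker(T-w)=n$ and $\operatorname{ran}(T-w)=\mathcal H$, and if the subspaces $\ker(T-w)$, $w\in\Omega$, span a dense subspace of $\mathcal H$. For such $T$ let $\mathcal K_T=-\frac{\partial}{\partial\overline w}\bigl(h^{-1}\frac{\partial h}{\partial w}\bigr)$ denote the curvature of the eigenvector bundle with fibres $\ker(T-w)$, where $h=(\langle\gamma_j,\gamma_i\rangle)_{i,j}$ is the Gram matrix of a local holomorphic frame $\gamma_1,\dots,\gamma_n$ of the bundle; $\operatorname{trace}\mathcal K_T$ does not depend on the frame, and for $n=1$ it is $\mathcal K_T$ itself. Write $$\begin{pmatrix}T_0&S\\0&T_1\end{pmatrix}\in\mathcal FB_2(\Omega)$$ (an operator on $\mathcal H_0\oplus\mathcal H_1$) if $T_0\in B_1(\Omega)$ on $\mathcal H_0$, $T_1\in B_1(\Omega)$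 on $\mathcal H_1$, and $S:\mathcal H_1\to\mathcal H_0$ is a non-zero bounded operator with $T_0S=ST_1$; such an operator belongs to $B_2(\Omega)$. A bounded operator $T$ is called homogeneous if $\varphi(T)$ is unitarily equivalent to $T$ for every linear fractional transformation $\varphi$ of the open unit disk onto itself, $\varphi(z)=c\,\frac{z-a}{1-\overline a z}$ with $|c|=1$ and $|a|<1$, that is analytic on $\sigma(T)$. **Proposition 1.9.** Let $T=\begin{pmatrix}T_0&S_{0,1}\\0&T_1\end{pmatrix}\in\mathcal FB_2(\Omega)$ be homogeneous, and let $\widetilde T=\begin{pmatrix}T_0&\widetilde S_{0,1}\\0&T_1\end{pmatrix}\in\mathcal FB_2(\Omega)$ satisfy $\operatorname{trace}\mathcal K_{\widetilde T}=\mathcal K_{T_0}+\mathcal K_{T_1}$ on $\Omega$. Then $\widetilde T$ is homogeneous, and $\widetilde T$ is similar to $T$ via a block-diagonal intertwiner: there is a bounded invertible operator $X_1$ on $\mathcal H_1$ such that $$\begin{pmatrix}I&0\\0&X_1\end{pmatrix}\widetilde T=T\begin{pmatrix}I&0\\0&X_1\end{pmatrix}.$$ -/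

import Mathlib

open scoped ComplexConjugate

noncomputable section

namespace CowenDouglas

/-- The Wirtinger derivative `∂f/∂w = (f_x - i f_y) / 2`. -/
def wirtinger (f : ℂ → ℂ) (w : ℂ) : ℂ :=
  (fderiv ℝ f w 1 - Complex.I * fderiv ℝ f w Complex.I) / 2

/-- The conjugate Wirtinger derivative `∂f/∂w̄ = (f_x + i f_y) / 2`. -/
def wirtingerBar (f : ℂ → ℂ) (w : ℂ) : ℂ :=
  (fderiv ℝ f w 1 + Complex.I * fderiv ℝ f w Complex.I) / 2

section SingleOperator

variable {H : Type*} [NormedAddCommGroup H] [InnerProductSpace ℂ H]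

/-- The eigenspace `ker (T - w)`, the fibre over `w` of the eigenvector bundle of `T`. -/
def fibre (T : H →L[ℂ] H) (w : ℂ) : Submodule ℂ H :=
  LinearMap.ker ((T - w • ContinuousLinearMap.id ℂ H : H →L[ℂ] H) : H →ₗ[ℂ] H)

/-- Membership of `T` in the Cowen-Douglas class `B_n(Ω)`. -/
structure MemB (n : ℕ) (Ω : Set ℂ) (T : H →L[ℂ] H) : Prop where
  subset_spectrum : Ω ⊆ spectrum ℂ T
  rank_fibre : ∀ w ∈ Ω, Module.rank ℂ (fibre T w) = n
  span_fibres : (⨆ w ∈ Ω, fibre T w).topologicalClosure = ⊤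
  range_eq : ∀ w ∈ Ω, Function.Surjective (T - w • ContinuousLinearMap.id ℂ H : H →L[ℂ] H)

/-- `γ` is a holomorphic frame of rank `n`, on some open neighbourhood of `w`, of the eigenvector
bundle of `T`. -/
def IsFrameAt {n : ℕ} (T : H →L[ℂ] H) (w : ℂ) (γ : Fin n → ℂ → H) : Prop :=
  ∃ V : Set ℂ, IsOpen V ∧ w ∈ V ∧
    (∀ i, DifferentiableOn ℂ (γ i) V) ∧
    ∀ z ∈ V, LinearIndependent ℂ (fun i => γ i z) ∧
      Submodule.span ℂ (Set.range fun i => γ i z) = fibre T z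

/-- The Gram matrix of `γ` at `z`. Mathlib's inner product is linear in its second argument, so
the `(i, j)` entry `inner ℂ (γ i z) (γ j z)` is `⟨γ_j(z), γ_i(z)⟩` for an inner product that is
linear in its first argument. -/
def gramMatrix {n : ℕ} (γ : Fin n → ℂ → H) (z : ℂ) : Matrix (Fin n) (Fin n) ℂ :=
  Matrix.of fun i j => inner ℂ (γ i z) (γ j z)

/-- The curvature `- ∂/∂w̄ (h⁻¹ ∂h/∂w)` in the frame `γ`, where `h` is the Gram matrix of `γ`
and matrices are differentiated entrywise. -/
def curvatureMatrix {n : ℕ} (γ : Fin n → ℂ → H) (w : ℂ) : Matrix (Fin n) (Fin n) ℂ :=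
  Matrix.of fun i j => - wirtingerBar (fun z =>
    ((gramMatrix γ z)⁻¹ * Matrix.of fun k l => wirtinger (fun u => gramMatrix γ u k l) z) i j) w

open Classical in
/-- The trace at `w` of the curvature of the rank `n` eigenvector bundle of `T`. It is computed in
a holomorphic frame near `w`; a change of frame conjugates the curvature matrix, so the trace does
not depend on the frame. For `n = 1` it is the curvature itself. -/
def traceCurvature (n : ℕ) (T : H →L[ℂ] H) (w : ℂ) : ℂ :=
  if h : ∃ γ : Fin n → ℂ → H, IsFrameAt T w γ then (curvatureMatrix h.choose w).trace else 0

/-- The curvature of the eigenvector line bundle of an operator of class `B_1`. -/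
def lineCurvature (T : H →L[ℂ] H) (w : ℂ) : ℂ := traceCurvature 1 T w

/-- Unitary equivalence of two operators on `H`. -/
def UnitarilyEquivalent (A B : H →L[ℂ] H) : Prop :=
  ∃ U : H ≃ₗᵢ[ℂ] H, ∀ x, U (A x) = B (U x)

/-- `φ(T) = c (T - a) (1 - ā T)⁻¹` for `φ(z) = c (z - a) / (1 - ā z)`. -/
def mobiusApply (c a : ℂ) (T : H →L[ℂ] H) : H →L[ℂ] H :=
  c • ((T - a • 1) * Ring.inverse (1 - conj a • T))

/-- `T` is homogeneous: `φ(T)` is unitarily equivalent to `T` for every linear fractional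
transformation `φ` of the open unit disk onto itself that is analytic on the spectrum of `T`.
These `φ` are the maps `φ(z) = c (z - a) / (1 - ā z)` with `|c| = 1` and `|a| < 1`. -/
def IsHomogeneous (T : H →L[ℂ] H) : Prop :=
  ∀ c a : ℂ, ‖c‖ = 1 → ‖a‖ < 1 → (∀ z ∈ spectrum ℂ T, 1 - conj a * z ≠ 0) →
    UnitarilyEquivalent (mobiusApply c a T) T

end SingleOperator

section Blocks

variable {H₀ H₁ : Type*} [NormedAddCommGroup H₀] [InnerProductSpace ℂ H₀]
  [NormedAddCommGroup H₁] [InnerProductSpace ℂ H₁]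

/-- The operator `(T₀, S; 0, T₁)` on the Hilbert space direct sum of `H₀` and `H₁`. -/
def upperTriangular (T₀ : H₀ →L[ℂ] H₀) (S : H₁ →L[ℂ] H₀) (T₁ : H₁ →L[ℂ] H₁) :
    WithLp 2 (H₀ × H₁) →L[ℂ] WithLp 2 (H₀ × H₁) :=
  ((WithLp.prodContinuousLinearEquiv 2 ℂ H₀ H₁).symm : (H₀ × H₁) →L[ℂ] WithLp 2 (H₀ × H₁)) ∘L
    ((T₀ ∘L ContinuousLinearMap.fst ℂ H₀ H₁ + S ∘L ContinuousLinearMap.snd ℂ H₀ H₁).prod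
      (T₁ ∘L ContinuousLinearMap.snd ℂ H₀ H₁)) ∘L
    (WithLp.prodContinuousLinearEquiv 2 ℂ H₀ H₁ : WithLp 2 (H₀ × H₁) →L[ℂ] (H₀ × H₁))

/-- The operator `(T₀, S; 0, T₁)` belongs to the class `FB_2(Ω)`. -/
structure MemFB2 (Ω : Set ℂ) (T₀ : H₀ →L[ℂ] H₀) (S : H₁ →L[ℂ] H₀) (T₁ : H₁ →L[ℂ] H₁) :
    Prop where
  memB_left : MemB 1 Ω T₀
  memB_right : MemB 1 Ω T₁
  ne_zero : S ≠ 0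
  intertwines : T₀ ∘L S = S ∘L T₁

/-- The invertible block-diagonal operator `(X₀, 0; 0, X₁)`. -/
def blockDiagonal (X₀ : H₀ ≃L[ℂ] H₀) (X₁ : H₁ ≃L[ℂ] H₁) :
    WithLp 2 (H₀ × H₁) ≃L[ℂ] WithLp 2 (H₀ × H₁) :=
  (WithLp.prodContinuousLinearEquiv 2 ℂ H₀ H₁).trans
    ((X₀.prodCongr X₁).trans (WithLp.prodContinuousLinearEquiv 2 ℂ H₀ H₁).symm)

end Blocks

end CowenDouglas

end

/-!
Every ingredient is read off from eigenvectors. If `t` is a local holomorphic frame of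
`ker (T₁ - w)`, then `σ = S t` is, off its zeros, a frame of `ker (T₀ - w)`, and `(σ, 0)`,
`(-σ', t)` is a frame of `ker (T - w)` (`MemFB2.isFrameAt`).

**Rigidity.** A unitary `U` that intertwines `φ(T)` and `T` is block diagonal
(`MemFB2.diagonal_of_intertwines`). The operator `N = (0, S; 0, 0)` is square-zero and commutes with
`T`, so `U N U⁻¹` is a square-zero element of the commutant of `T`. By the Kleinecke-Shirokov
theorem the commutant consists of upper triangular operators, and the diagonal of a square-zero one
vanishes. Hence `U` maps the range of `S`, which is dense in the first summand, into the first
summand, and so does `U⁻¹`.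

**An invariant.** For `(x, y)` in `ker (T - w)` with `y ≠ 0`, the number
`dist (x, ker (T₀ - w))² / ‖y‖²` depends on `w` only and is preserved by block diagonal unitary
operators. For homogeneous `T` it is therefore constant near each point of `Ω` off the unit circle
(`MemFB2.eventually_gramDet_mul_eq`). In terms of `σ` it is
`r = gramDet σ σ' / (‖σ‖² ‖t‖²) > 0`.

**Curvature.** The trace of the curvature is `-∂²/∂w̄∂w log det h` in any holomorphic frame. Write
`S' t = g σ` with `g` holomorphic. The frame `(σ, 0)`, `(-g σ', t)` of `ker (T' - w)`, where
`T' = (T₀, S'; 0, T₁)`, has Gram determinant `‖σ‖² ‖t‖² (1 + r |g|²)`, so the trace condition says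
that `log (1 + r |g|²)` is harmonic. This makes `g` constant near one point, and `S' = g S` follows
by unique continuation (`MemFB2.exists_eq_smul`). The operator `(1, 0; 0, g)` then is the required
intertwiner, and homogeneity passes to `(T₀, g S; 0, T₁)` because the unitary operators concerned
are block diagonal (`MemFB2.isHomogeneous_smul`).
-/

namespace CowenDouglas

open Topology Filter

/-! ### Eigenvector bundles and unique continuation -/

section Fibres

variable {H : Type*} [NormedAddCommGroup H] [InnerProductSpace ℂ H]

theorem mem_fibre {T : H →L[ℂ] H} {w : ℂ} {x : H} : x ∈ fibre T w ↔ T x = w • x := by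
  simp [fibre, sub_eq_zero]

theorem MemB.finrank_fibre {Ω : Set ℂ} {T : H →L[ℂ] H} (hT : MemB 1 Ω T) {w : ℂ} (hw : w ∈ Ω) :
    Module.finrank ℂ (fibre T w) = 1 := by
  rw [Module.finrank, hT.rank_fibre w hw]
  simp

theorem MemB.exists_smul_eq {Ω : Set ℂ} {T : H →L[ℂ] H} (hT : MemB 1 Ω T) {w : ℂ}
    (hw : w ∈ Ω) {x y : H}
    (hx : x ∈ fibre T w) (hx0 : x ≠ 0) (hy : y ∈ fibre T w) : ∃ c : ℂ, y = c • x := by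
  have hne : (⟨x, hx⟩ : fibre T w) ≠ 0 := fun h => hx0 (congrArg Subtype.val h)
  obtain ⟨c, hc⟩ := (finrank_eq_one_iff_of_nonzero' _ hne).1 (hT.finrank_fibre hw) ⟨y, hy⟩
  exact ⟨c, (congrArg Subtype.val hc).symm⟩

/-- A surjective operator on a Hilbert space has a bounded right inverse: the inverse of its
restriction to the orthogonal complement of its kernel. -/
theorem exists_rightInverse_of_surjective [CompleteSpace H] (A : H →L[ℂ] H)
    (hA : Function.Surjective A) : ∃ R : H →L[ℂ] H, ∀ x, A (R x) = x := by
  set K : Submodule ℂ H := LinearMap.ker (A : H →ₗ[ℂ] H)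
  have hKc : IsClosed (K : Set H) := A.isClosed_ker
  have : CompleteSpace K := hKc.completeSpace_coe
  have hbij : Function.Bijective (A ∘L Kᗮ.subtypeL) := by
    constructor
    · rw [injective_iff_map_eq_zero]
      rintro ⟨x, hx⟩ h
      have hxK : x ∈ K := by simpa [K] using h
      have : x ∈ K ⊓ Kᗮ := ⟨hxK, hx⟩
      rw [Submodule.inf_orthogonal_eq_bot] at this
      simpa using this
    · intro y
      obtain ⟨x, rfl⟩ := hA y
      obtain ⟨k, hk, p, hp, rfl⟩ := K.exists_add_mem_mem_orthogonal x
      refine ⟨⟨p, hp⟩, ?_⟩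
      have hk' : A k = 0 := by simpa [K] using hk
      simp [hk']
  let e := ContinuousLinearEquiv.ofBijective (A ∘L Kᗮ.subtypeL)
    (LinearMap.ker_eq_bot.2 hbij.1) (LinearMap.range_eq_top.2 hbij.2)
  refine ⟨Kᗮ.subtypeL ∘L (e.symm : H →L[ℂ] Kᗮ), fun x => ?_⟩
  exact e.apply_symm_apply x

/-- Near a point `w` of `Ω`, the eigenvector bundle of an operator of class `B_1(Ω)` has a
holomorphic frame, namely `(1 - (z - w) R)⁻¹ e`, where `R` is a right inverse of `T - w` and `e`
spans `ker (T - w)`: indeed `T - z = (T - w) (1 - (z - w) R)`. -/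
theorem MemB.exists_line_frame [CompleteSpace H] {Ω : Set ℂ} {T : H →L[ℂ] H} (hT : MemB 1 Ω T)
    {w : ℂ} (hw : w ∈ Ω) :
    ∃ r > 0, ∃ t : ℂ → H, DifferentiableOn ℂ t (Metric.ball w r) ∧
      ∀ z ∈ Metric.ball w r, t z ≠ 0 ∧ fibre T z = Submodule.span ℂ {t z} := by
  obtain ⟨R, hR⟩ := exists_rightInverse_of_surjective _ (hT.range_eq w hw)
  obtain ⟨⟨e, heT⟩, he0, hespan⟩ := finrank_eq_one_iff'.1 (hT.finrank_fibre hw)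
  have he0 : e ≠ 0 := fun h => he0 (by simpa using h)
  let L : ℂ → H →L[ℂ] H := fun z => 1 - (z - w) • R
  have hLd : Differentiable ℂ L := by
    intro z; fun_prop
  have hopen : IsOpen {z | IsUnit (L z)} := Units.isOpen.preimage hLd.continuous
  have hwm : w ∈ {z | IsUnit (L z)} := by simp [L]
  obtain ⟨r, hr, hball⟩ := Metric.isOpen_iff.1 hopen w hwm
  refine ⟨r, hr, fun z => Ring.inverse (L z) e, ?_, fun z hz => ?_⟩
  · have h1 : DifferentiableOn ℂ (fun z => Ring.inverse (L z)) (Metric.ball w r) :=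
      DifferentiableOn.comp (g := Ring.inverse) (t := {A | IsUnit A}) differentiableOn_inverse
        hLd.differentiableOn (fun z hz => hball hz)
    exact h1.clm_apply (differentiableOn_const e)
  · have hu : IsUnit (L z) := hball hz
    have hinv1 : ∀ x, L z (Ring.inverse (L z) x) = x := fun x => by
      have := Ring.mul_inverse_cancel _ hu
      simpa using congrArg (fun A : H →L[ℂ] H => A x) this
    have hinv2 : ∀ x, Ring.inverse (L z) (L z x) = x := fun x => by
      have := Ring.inverse_mul_cancel _ hu
      simpa using congrArg (fun A : H →L[ℂ] H => A x) this
    have hfac : ∀ x, T x - z • x = T (L z x) - w • L z x := fun x => by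
      have h := hR x
      simp only [sub_apply, smul_apply, ContinuousLinearMap.id_apply] at h
      have h' : T (R x) = x + w • R x := eq_add_of_sub_eq h
      simp only [L, sub_apply, smul_apply, one_apply_eq_self, map_sub, map_smul, h']
      module
    have hmem : ∀ x, x ∈ fibre T z ↔ L z x ∈ fibre T w := fun x => by
      rw [mem_fibre, mem_fibre, ← sub_eq_zero, hfac, sub_eq_zero]
    refine ⟨fun h => he0 ?_, ?_⟩
    · have := hinv1 e
      rw [show Ring.inverse (L z) e = 0 from h, map_zero] at this
      exact this.symm
    · ext x
      rw [hmem, Submodule.mem_span_singleton]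
      constructor
      · intro hx
        obtain ⟨c, hc⟩ := hespan ⟨_, hx⟩
        refine ⟨c, ?_⟩
        have hc' : c • e = L z x := congrArg Subtype.val hc
        rw [← map_smul, hc', hinv2]
      · rintro ⟨c, rfl⟩
        rw [map_smul, hinv1]
        exact Submodule.smul_mem _ _ heT

/-- A bounded operator is determined by its values on the eigenvectors of `T`. -/
theorem MemB.eq_zero_of_fibres {Ω : Set ℂ} {T : H →L[ℂ] H} {n : ℕ} (hT : MemB n Ω T)
    {F : Type*} [NormedAddCommGroup F] [NormedSpace ℂ F]
    (A : H →L[ℂ] F) (h : ∀ w ∈ Ω, ∀ x ∈ fibre T w, A x = 0) : A = 0 := by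
  have hker : (⨆ w ∈ Ω, fibre T w).topologicalClosure ≤ LinearMap.ker (A : H →ₗ[ℂ] F) := by
    refine Submodule.topologicalClosure_minimal _ ?_ A.isClosed_ker
    exact iSup₂_le fun z hz x hx => h z hz x hx
  rw [hT.span_fibres, top_le_iff] at hker
  ext x
  have : x ∈ LinearMap.ker (A : H →ₗ[ℂ] F) := hker ▸ Submodule.mem_top
  simpa using this

/-- Unique continuation: a bounded operator that vanishes on the eigenvectors of `T` over a
neighbourhood of one point of `Ω` vanishes. -/
theorem MemB.eq_zero_of_eventually [CompleteSpace H] {Ω : Set ℂ} (hΩ : IsPreconnected Ω)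
    {T : H →L[ℂ] H} (hT : MemB 1 Ω T) {F : Type*} [NormedAddCommGroup F] [NormedSpace ℂ F]
    [CompleteSpace F] (A : H →L[ℂ] F) {w : ℂ} (hw : w ∈ Ω)
    (h : ∀ᶠ z in 𝓝 w, ∀ x ∈ fibre T z, A x = 0) : A = 0 := by
  let C : Set ℂ := {w | ∀ᶠ z in 𝓝 w, ∀ x ∈ fibre T z, A x = 0}
  have hC : IsOpen C := isOpen_setOfPred_eventually_nhds
  have hsub : Ω ⊆ C := by
    refine hΩ.subset_of_closure_inter_subset hC ⟨w, hw, h⟩ ?_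
    rintro v ⟨hvC, hvΩ⟩
    obtain ⟨r, hr, t, htd, ht⟩ := hT.exists_line_frame hvΩ
    obtain ⟨u, huC, hur⟩ := Metric.mem_closure_iff.1 hvC r hr
    have hu : u ∈ Metric.ball v r := by rwa [Metric.mem_ball, dist_comm]
    have hAt : DifferentiableOn ℂ (fun z => A (t z)) (Metric.ball v r) :=
      A.differentiable.comp_differentiableOn htd
    have hzero : Set.EqOn (fun z => A (t z)) 0 (Metric.ball v r) := by
      refine (hAt.analyticOnNhd Metric.isOpen_ball).eqOn_zero_of_preconnected_of_eventuallyEq_zero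
        (convex_ball v r).isPreconnected hu ?_
      filter_upwards [huC, Metric.isOpen_ball.mem_nhds hu] with z hz hzb
      exact hz _ (by rw [(ht z hzb).2]; exact Submodule.mem_span_singleton_self _)
    filter_upwards [Metric.ball_mem_nhds v hr] with z hz x hx
    rw [(ht z hz).2, Submodule.mem_span_singleton] at hx
    obtain ⟨c, rfl⟩ := hx
    have : A (t z) = 0 := hzero hz
    rw [map_smul, this, smul_zero]
  exact hT.eq_zero_of_fibres A fun z hz => (hsub hz).self_of_nhds

end Fibres

/-! ### The Kleinecke-Shirokov theorem -/

section KleineckeShirokov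

variable {R : Type*} [Ring R]

/-- Leibniz rule for the iterates of `X ↦ T X - X T`, applied to a product whose left factor is
killed by two of them. -/
theorem iterate_commutator_mul {T A B : R} (hAB : T * B - B * T = A) (hAT : A * T = T * A)
    (X : R) (m : ℕ) :
    (fun X => T * X - X * T)^[m + 1] (B * X) =
      B * (fun X => T * X - X * T)^[m + 1] X +
        ((m : R) + 1) * (A * (fun X => T * X - X * T)^[m] X) := by
  induction m with
  | zero =>
    simp only [zero_add, Function.iterate_one, Function.iterate_zero, id_eq, Nat.cast_zero,
      one_mul, ← hAB]
    noncomm_ring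
  | succ m ih =>
    rw [Function.iterate_succ_apply', ih, Function.iterate_succ_apply' _ (m + 1)]
    set Z := (fun X => T * X - X * T)^[m] X with hZ
    have hY : (fun X => T * X - X * T)^[m + 1] X = T * Z - Z * T := by
      rw [Function.iterate_succ_apply']
    rw [hY]
    have hTB : T * B = B * T + A := by rw [← hAB]; abel
    have hm : T * ((m : R) + 1) = ((m : R) + 1) * T := by
      rw [mul_add, add_mul, (Nat.cast_commute m T).eq, mul_one, one_mul]
    set k : R := (m : R) + 1
    have e1 : T * (B * (T * Z - Z * T)) = B * (T * (T * Z - Z * T)) + A * (T * Z - Z * T) := by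
      rw [← mul_assoc, hTB]; noncomm_ring
    have e2 : T * (k * (A * Z)) = k * (A * (T * Z)) := by
      rw [← mul_assoc, hm, mul_assoc, ← mul_assoc T, ← hAT, mul_assoc]
    have e3 : (((m + 1 : ℕ) : R) + 1) = k + 1 := by push_cast; rfl
    rw [e3]
    simp only [mul_add, add_mul, e1, e2]
    noncomm_ring

/-- The right-hand side is killed by one more commutator with `T`, as the Leibniz rule needs in the
induction step. -/
theorem iterate_commutator_pow {T A B : R} (hAB : T * B - B * T = A) (hAT : A * T = T * A)
    (n : ℕ) : (fun X => T * X - X * T)^[n] (B ^ n) = (n.factorial : R) * A ^ n := by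
  induction n with
  | zero => simp
  | succ n ih =>
    have hA : Commute (A ^ n) T := Commute.pow_left hAT n
    have hz : (fun X => T * X - X * T)^[n + 1] (B ^ n) = 0 := by
      rw [Function.iterate_succ_apply', ih]
      have : T * ((n.factorial : R) * A ^ n) = (n.factorial : R) * A ^ n * T := by
        rw [← mul_assoc, ← (Nat.cast_commute n.factorial T).eq, mul_assoc, mul_assoc, hA.eq]
      simp [this]
    rw [pow_succ' B, iterate_commutator_mul hAB hAT, hz, ih, mul_zero, zero_add, pow_succ' A,
      Nat.factorial_succ]
    have : A * ((n.factorial : R) * A ^ n) = (n.factorial : R) * (A * A ^ n) := by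
      rw [← mul_assoc, ← (Nat.cast_commute n.factorial A).eq, mul_assoc]
    rw [this, ← mul_assoc]
    push_cast
    rfl

/-- A case of the Kleinecke-Shirokov theorem: a commutator `A = T B - B T` that commutes with `T`
is quasinilpotent, hence has no eigenvalue besides `0`. -/
theorem eigenvalue_eq_zero_of_commutator {H : Type*} [NormedAddCommGroup H] [NormedSpace ℂ H]
    {T A B : H →L[ℂ] H} (hAB : T * B - B * T = A) (hAT : A * T = T * A) {x : H} (hx : x ≠ 0)
    {a : ℂ} (hax : A x = a • x) : a = 0 := by
  by_contra ha
  have hD : ∀ (n : ℕ) (X : H →L[ℂ] H),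
      ‖(fun X => T * X - X * T)^[n] X‖ ≤ (2 * ‖T‖) ^ n * ‖X‖ := by
    intro n X
    induction n with
    | zero => simp
    | succ n ih =>
      rw [Function.iterate_succ_apply']
      set Y := (fun X => T * X - X * T)^[n] X
      calc ‖T * Y - Y * T‖ ≤ ‖T‖ * ‖Y‖ + ‖Y‖ * ‖T‖ :=
            (norm_sub_le _ _).trans (add_le_add (norm_mul_le _ _) (norm_mul_le _ _))
        _ = 2 * ‖T‖ * ‖Y‖ := by ring
        _ ≤ 2 * ‖T‖ * ((2 * ‖T‖) ^ n * ‖X‖) := by gcongr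
        _ = _ := by ring
  have hpow : ∀ n : ℕ, (A ^ n) x = a ^ n • x := by
    intro n
    induction n with
    | zero => simp
    | succ n ih => rw [pow_succ', mul_apply_eq_comp, ih, map_smul, hax, smul_smul, pow_succ]
  have hbound : ∀ n : ℕ, 0 < n → 1 ≤ (2 * ‖T‖ * ‖B‖ / ‖a‖) ^ n / n.factorial := by
    intro n hn
    have h1 := hD n (B ^ n)
    rw [iterate_commutator_pow hAB hAT] at h1
    have h2 : (n.factorial : ℝ) * (‖a‖ ^ n * ‖x‖) ≤ (2 * ‖T‖) ^ n * ‖B‖ ^ n * ‖x‖ := by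
      have h3 : ((n.factorial : H →L[ℂ] H) * A ^ n) x = (n.factorial : ℂ) • a ^ n • x := by
        rw [← nsmul_eq_mul, smul_apply, hpow, Nat.cast_smul_eq_nsmul]
      have h4 := ((n.factorial : H →L[ℂ] H) * A ^ n).le_opNorm x
      rw [h3, norm_smul, norm_smul, norm_pow, Complex.norm_natCast] at h4
      refine h4.trans ?_
      gcongr
      refine h1.trans ?_
      gcongr
      exact norm_pow_le' B hn
    have hx' : 0 < ‖x‖ := norm_pos_iff.2 hx
    have ha' : 0 < ‖a‖ := norm_pos_iff.2 ha
    have hf : (0 : ℝ) < n.factorial := by exact_mod_cast n.factorial_pos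
    rw [le_div_iff₀ hf, div_pow, le_div_iff₀ (by positivity), mul_pow]
    rw [← mul_assoc] at h2
    rw [one_mul]
    exact le_of_mul_le_mul_right h2 hx'
  have hlim := FloorSemiring.tendsto_pow_div_factorial_atTop (2 * ‖T‖ * ‖B‖ / ‖a‖)
  have := ge_of_tendsto hlim ((eventually_gt_atTop 0).mono hbound)
  linarith

end KleineckeShirokov

/-! ### The commutant of an operator of class `FB_2` -/

section Blocks

theorem block_ext {E F : Type*} {x y : WithLp 2 (E × F)} (h₀ : x.fst = y.fst) (h₁ : x.snd = y.snd) :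
    x = y :=
  (WithLp.ofLp_injective 2) (Prod.ext h₀ h₁)

variable {H₀ H₁ : Type*} [NormedAddCommGroup H₀] [InnerProductSpace ℂ H₀]
  [NormedAddCommGroup H₁] [InnerProductSpace ℂ H₁]

variable (H₀ H₁) in
/-- The embedding of `H₀` as the first summand of the Hilbert space direct sum. -/
noncomputable def inlL : H₀ →L[ℂ] WithLp 2 (H₀ × H₁) :=
  ((WithLp.prodContinuousLinearEquiv 2 ℂ H₀ H₁).symm : (H₀ × H₁) →L[ℂ] WithLp 2 (H₀ × H₁)) ∘L
    ContinuousLinearMap.inl ℂ H₀ H₁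

variable (H₀ H₁) in
/-- The embedding of `H₁` as the second summand of the Hilbert space direct sum. -/
noncomputable def inrL : H₁ →L[ℂ] WithLp 2 (H₀ × H₁) :=
  ((WithLp.prodContinuousLinearEquiv 2 ℂ H₀ H₁).symm : (H₀ × H₁) →L[ℂ] WithLp 2 (H₀ × H₁)) ∘L
    ContinuousLinearMap.inr ℂ H₀ H₁

@[simp] theorem inlL_fst (x : H₀) : (inlL H₀ H₁ x).fst = x := rfl
@[simp] theorem inlL_snd (x : H₀) : (inlL H₀ H₁ x).snd = 0 := rfl
@[simp] theorem inrL_fst (y : H₁) : (inrL H₀ H₁ y).fst = 0 := rfl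
@[simp] theorem inrL_snd (y : H₁) : (inrL H₀ H₁ y).snd = y := rfl

theorem inlL_add_inrL (z : WithLp 2 (H₀ × H₁)) : inlL H₀ H₁ z.fst + inrL H₀ H₁ z.snd = z :=
  block_ext (by simp) (by simp)

variable {T₀ : H₀ →L[ℂ] H₀} {S : H₁ →L[ℂ] H₀} {T₁ : H₁ →L[ℂ] H₁}

@[simp] theorem upperTriangular_fst (z : WithLp 2 (H₀ × H₁)) :
    (upperTriangular T₀ S T₁ z).fst = T₀ z.fst + S z.snd := rfl
@[simp] theorem upperTriangular_snd (z : WithLp 2 (H₀ × H₁)) :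
    (upperTriangular T₀ S T₁ z).snd = T₁ z.snd := rfl

theorem upperTriangular_inlL (x : H₀) :
    upperTriangular T₀ S T₁ (inlL H₀ H₁ x) = inlL H₀ H₁ (T₀ x) :=
  block_ext (by simp) (by simp)

theorem upperTriangular_inrL (y : H₁) :
    upperTriangular T₀ S T₁ (inrL H₀ H₁ y) = inlL H₀ H₁ (S y) + inrL H₀ H₁ (T₁ y) :=
  block_ext (by simp) (by simp)

theorem mem_fibre_upperTriangular {w : ℂ} {z : WithLp 2 (H₀ × H₁)} :
    z ∈ fibre (upperTriangular T₀ S T₁) w ↔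
      T₀ z.fst + S z.snd = w • z.fst ∧ T₁ z.snd = w • z.snd := by
  rw [mem_fibre]
  constructor
  · intro h
    exact ⟨by simpa using congrArg WithLp.fst h, by simpa using congrArg WithLp.snd h⟩
  · rintro ⟨h₀, h₁⟩
    exact block_ext (by simpa using h₀) (by simpa using h₁)

variable {Ω : Set ℂ}

theorem MemFB2.map_mem_fibre (hT : MemFB2 Ω T₀ S T₁) {w : ℂ} {y : H₁} (hy : y ∈ fibre T₁ w) :
    S y ∈ fibre T₀ w := by
  rw [mem_fibre] at hy ⊢
  have : T₀ (S y) = S (T₁ y) := congrArg (fun A : H₁ →L[ℂ] H₀ => A y) hT.intertwines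
  rw [this, hy, map_smul]

/-- The range of `S` is dense: near a suitable point of `Ω` it contains the eigenvectors of `T₀`. -/
theorem MemFB2.eq_zero_of_comp_eq_zero [CompleteSpace H₀] [CompleteSpace H₁]
    (hΩ : IsOpen Ω) (hΩc : IsPreconnected Ω) (hT : MemFB2 Ω T₀ S T₁)
    {F : Type*} [NormedAddCommGroup F] [NormedSpace ℂ F] [CompleteSpace F] {A : H₀ →L[ℂ] F}
    (hA : ∀ y, A (S y) = 0) : A = 0 := by
  obtain ⟨w, hw, y, hy, hSy⟩ : ∃ w ∈ Ω, ∃ y ∈ fibre T₁ w, S y ≠ 0 := by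
    by_contra! h
    exact hT.ne_zero (hT.memB_right.eq_zero_of_fibres S h)
  obtain ⟨r, hr, t, htd, ht⟩ := hT.memB_right.exists_line_frame hw
  have hwr : w ∈ Metric.ball w r := Metric.mem_ball_self hr
  have hSt : S (t w) ≠ 0 := fun h => by
    rw [(ht w hwr).2, Submodule.mem_span_singleton] at hy
    obtain ⟨c, rfl⟩ := hy
    exact hSy (by rw [map_smul, h, smul_zero])
  have hcont : ContinuousAt (fun z => S (t z)) w :=
    S.continuous.continuousAt.comp
      (htd.continuousOn.continuousAt (Metric.isOpen_ball.mem_nhds hwr))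
  refine hT.memB_left.eq_zero_of_eventually hΩc A hw ?_
  filter_upwards [hcont.eventually_ne hSt, Metric.ball_mem_nhds w hr, hΩ.mem_nhds hw]
    with z hz hzr hzΩ x hx
  have htz : t z ∈ fibre T₁ z := by
    rw [(ht z hzr).2]; exact Submodule.mem_span_singleton_self _
  obtain ⟨c, rfl⟩ := hT.memB_left.exists_smul_eq hzΩ (hT.map_mem_fibre htz) hz hx
  rw [map_smul, hA, smul_zero]

/-- Every operator in the commutant of an operator of class `FB_2(Ω)` is upper triangular: its
lower left entry `Y₂₁` satisfies `Y₂₁ S = T₁ Y₂₂ - Y₂₂ T₁`, a commutator that commutes with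
`T₁`. -/
theorem MemFB2.snd_eq_zero_of_commute [CompleteSpace H₀] [CompleteSpace H₁]
    (hΩ : IsOpen Ω) (hΩc : IsPreconnected Ω) (hT : MemFB2 Ω T₀ S T₁)
    {Y : WithLp 2 (H₀ × H₁) →L[ℂ] WithLp 2 (H₀ × H₁)}
    (hY : Commute Y (upperTriangular T₀ S T₁)) (x : H₀) : (Y (inlL H₀ H₁ x)).snd = 0 := by
  have hY' : ∀ z, Y (upperTriangular T₀ S T₁ z) = upperTriangular T₀ S T₁ (Y z) := fun z =>
    congrArg (fun A : WithLp 2 (H₀ × H₁) →L[ℂ] WithLp 2 (H₀ × H₁) => A z) hY.eq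
  let Y₂₁ : H₀ →L[ℂ] H₁ := WithLp.sndL 2 ℂ H₀ H₁ ∘L Y ∘L inlL H₀ H₁
  let Y₂₂ : H₁ →L[ℂ] H₁ := WithLp.sndL 2 ℂ H₀ H₁ ∘L Y ∘L inrL H₀ H₁
  have h21 : ∀ x, Y₂₁ (T₀ x) = T₁ (Y₂₁ x) := fun x => by
    have := congrArg WithLp.snd (hY' (inlL H₀ H₁ x))
    rwa [upperTriangular_inlL, upperTriangular_snd] at this
  have h22 : ∀ y, Y₂₁ (S y) + Y₂₂ (T₁ y) = T₁ (Y₂₂ y) := fun y => by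
    have := congrArg WithLp.snd (hY' (inrL H₀ H₁ y))
    rwa [upperTriangular_inrL, upperTriangular_snd, map_add] at this
  have hcomm : T₁ * Y₂₂ - Y₂₂ * T₁ = Y₂₁ ∘L S := by
    ext y
    exact (eq_sub_of_add_eq (h22 y)).symm
  have hT₀S : ∀ y, T₀ (S y) = S (T₁ y) := fun y =>
    congrArg (fun A : H₁ →L[ℂ] H₀ => A y) hT.intertwines
  have hcomm' : (Y₂₁ ∘L S) * T₁ = T₁ * (Y₂₁ ∘L S) := by
    ext y
    change Y₂₁ (S (T₁ y)) = T₁ (Y₂₁ (S y))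
    rw [← hT₀S, h21]
  have hzero : Y₂₁ ∘L S = 0 := by
    refine hT.memB_right.eq_zero_of_fibres _ fun w hw y hy => ?_
    rcases eq_or_ne y 0 with rfl | hy0
    · simp
    · have hmem : (Y₂₁ ∘L S) y ∈ fibre T₁ w := by
        rw [mem_fibre] at hy ⊢
        have := congrArg (fun A : H₁ →L[ℂ] H₁ => A y) hcomm'
        change (Y₂₁ ∘L S) (T₁ y) = T₁ ((Y₂₁ ∘L S) y) at this
        rw [← this, hy, map_smul]
      obtain ⟨a, ha⟩ := hT.memB_right.exists_smul_eq hw hy hy0 hmem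
      rw [ha, eigenvalue_eq_zero_of_commutator hcomm hcomm' hy0 ha, zero_smul]
  have h0 : Y₂₁ = 0 := hT.eq_zero_of_comp_eq_zero hΩ hΩc fun y =>
    congrArg (fun A : H₁ →L[ℂ] H₁ => A y) hzero
  exact congrArg (fun A : H₀ →L[ℂ] H₁ => A x) h0

/-- A square-zero operator in the commutant has its range in the first summand. -/
theorem MemFB2.snd_eq_zero_of_commute_of_sq_eq_zero [CompleteSpace H₀] [CompleteSpace H₁]
    (hΩ : IsOpen Ω) (hΩc : IsPreconnected Ω) (hT : MemFB2 Ω T₀ S T₁)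
    {Y : WithLp 2 (H₀ × H₁) →L[ℂ] WithLp 2 (H₀ × H₁)}
    (hY : Commute Y (upperTriangular T₀ S T₁)) (hYY : Y * Y = 0) (z : WithLp 2 (H₀ × H₁)) :
    (Y z).snd = 0 := by
  have hl := hT.snd_eq_zero_of_commute hΩ hΩc hY
  have hY' : ∀ z, Y (upperTriangular T₀ S T₁ z) = upperTriangular T₀ S T₁ (Y z) := fun z =>
    congrArg (fun A : WithLp 2 (H₀ × H₁) →L[ℂ] WithLp 2 (H₀ × H₁) => A z) hY.eq
  let Y₂₂ : H₁ →L[ℂ] H₁ := WithLp.sndL 2 ℂ H₀ H₁ ∘L Y ∘L inrL H₀ H₁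
  have hsnd : ∀ z, (Y z).snd = Y₂₂ z.snd := fun z => by
    conv_lhs => rw [← inlL_add_inrL z, map_add, WithLp.add_snd, hl, zero_add]
    rfl
  have hcomm : ∀ y, Y₂₂ (T₁ y) = T₁ (Y₂₂ y) := fun y => by
    have := congrArg WithLp.snd (hY' (inrL H₀ H₁ y))
    rwa [hsnd, upperTriangular_snd, upperTriangular_snd, hsnd, inrL_snd] at this
  have hsq : ∀ y, Y₂₂ (Y₂₂ y) = 0 := fun y => by
    have h1 : Y (Y (inrL H₀ H₁ y)) = 0 :=
      congrArg (fun A : WithLp 2 (H₀ × H₁) →L[ℂ] WithLp 2 (H₀ × H₁) => A (inrL H₀ H₁ y)) hYY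
    have := congrArg WithLp.snd h1
    rwa [hsnd, hsnd, inrL_snd] at this
  have hzero : Y₂₂ = 0 := by
    refine hT.memB_right.eq_zero_of_fibres _ fun w hw y hy => ?_
    rcases eq_or_ne y 0 with rfl | hy0
    · simp
    · have hmem : Y₂₂ y ∈ fibre T₁ w := by
        rw [mem_fibre] at hy ⊢
        rw [← hcomm, hy, map_smul]
      obtain ⟨a, ha⟩ := hT.memB_right.exists_smul_eq hw hy hy0 hmem
      have h2 := hsq y
      rw [ha, map_smul, ha, smul_smul, smul_eq_zero] at h2
      have ha0 : a = 0 := by simpa using h2.resolve_right hy0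
      rw [ha, ha0, zero_smul]
  rw [hsnd, hzero]
  rfl

/-- The operator `N = (0, S; 0, 0)` is square-zero and commutes with `T = (T₀, S; 0, T₁)`. If its
conjugate `U N U⁻¹` also commutes with `T`, then `U` maps the range of `N`, hence all of the first
summand, into the first summand. -/
theorem MemFB2.snd_eq_zero_of_commute_conj [CompleteSpace H₀] [CompleteSpace H₁]
    (hΩ : IsOpen Ω) (hΩc : IsPreconnected Ω) (hT : MemFB2 Ω T₀ S T₁)
    {U V : WithLp 2 (H₀ × H₁) →L[ℂ] WithLp 2 (H₀ × H₁)} (hVU : V * U = 1)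
    (hY : Commute (U * upperTriangular 0 S 0 * V) (upperTriangular T₀ S T₁)) (x : H₀) :
    (U (inlL H₀ H₁ x)).snd = 0 := by
  have hN : upperTriangular (0 : H₀ →L[ℂ] H₀) S (0 : H₁ →L[ℂ] H₁) * upperTriangular 0 S 0 = 0 := by
    ext z
    exact block_ext (by simp) (by simp)
  have hsq : U * upperTriangular 0 S 0 * V * (U * upperTriangular 0 S 0 * V) = 0 := by
    calc _ = U * upperTriangular 0 S 0 * (V * U) * upperTriangular 0 S 0 * V := by
          simp only [mul_assoc]
      _ = U * (upperTriangular 0 S 0 * upperTriangular 0 S 0) * V := by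
          rw [hVU, mul_one]; simp only [mul_assoc]
      _ = 0 := by rw [hN]; simp
  have key := hT.snd_eq_zero_of_commute_of_sq_eq_zero hΩ hΩc hY hsq
  let A : H₀ →L[ℂ] H₁ := WithLp.sndL 2 ℂ H₀ H₁ ∘L U ∘L inlL H₀ H₁
  have hA : A = 0 := by
    refine hT.eq_zero_of_comp_eq_zero hΩ hΩc fun y => ?_
    have h1 := key (U (inrL H₀ H₁ y))
    have h2 : V (U (inrL H₀ H₁ y)) = inrL H₀ H₁ y :=
      congrArg (fun A : WithLp 2 (H₀ × H₁) →L[ℂ] WithLp 2 (H₀ × H₁) => A (inrL H₀ H₁ y)) hVU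
    rw [mul_apply_eq_comp, mul_apply_eq_comp, h2,
      upperTriangular_inrL] at h1
    simpa [A] using h1
  exact congrArg (fun A : H₀ →L[ℂ] H₁ => A x) hA

theorem MemFB2.commute_corner (hT : MemFB2 Ω T₀ S T₁) :
    Commute (upperTriangular 0 S 0) (upperTriangular T₀ S T₁) := by
  have h : ∀ y, T₀ (S y) = S (T₁ y) := fun y =>
    congrArg (fun A : H₁ →L[ℂ] H₀ => A y) hT.intertwines
  ext z
  exact block_ext (by simp [h]) (by simp)

end Blocks

/-! ### Möbius transformations of operators -/

section Moebius

variable {H : Type*} [NormedAddCommGroup H] [InnerProductSpace ℂ H] {T X : H →L[ℂ] H} {c a : ℂ}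

theorem mobiusApply_mul (hu : IsUnit (1 - conj a • T)) :
    mobiusApply c a T * (1 - conj a • T) = c • (T - a • 1) := by
  rw [mobiusApply, smul_mul_assoc, mul_assoc, Ring.inverse_mul_cancel _ hu, mul_one]

theorem commute_ringInverse_right {R : Type*} [Ring R] {X P : R} (hu : IsUnit P)
    (h : Commute X P) : Commute X (Ring.inverse P) := by
  obtain ⟨u, rfl⟩ := hu
  rw [Ring.inverse_unit]
  exact h.units_inv_right

theorem commute_mobiusApply (hu : IsUnit (1 - conj a • T)) (h : Commute X T) :
    Commute X (mobiusApply c a T) := by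
  have h1 : Commute X (1 - conj a • T) := (Commute.one_right X).sub_right (h.smul_right _)
  exact ((h.sub_right ((Commute.one_right X).smul_right _)).mul_right
    (commute_ringInverse_right hu h1)).smul_right _

/-- The commutant of `φ(T)` is contained in that of `T`, since
`c (1 - |a|²) (1 - ā T)⁻¹ = c + ā φ(T)`. -/
theorem commute_of_commute_mobiusApply (hu : IsUnit (1 - conj a • T)) (hc : c ≠ 0) (ha : ‖a‖ < 1)
    (h : Commute X (mobiusApply c a T)) : Commute X T := by
  set P := 1 - conj a • T with hP
  have hne : c * (1 - conj a * a) ≠ 0 := by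
    refine mul_ne_zero hc (sub_ne_zero.2 fun h1 => ?_)
    rw [mul_comm, Complex.mul_conj, Complex.normSq_eq_norm_sq] at h1
    have h2 : ‖a‖ ^ 2 = 1 := by exact_mod_cast h1.symm
    nlinarith [norm_nonneg a]
  have hW : (c * (1 - conj a * a)) • Ring.inverse P = c • 1 + conj a • mobiusApply c a T := by
    have h1 : (c • 1 : H →L[ℂ] H) = c • (P * Ring.inverse P) := by
      rw [Ring.mul_inverse_cancel _ hu]
    rw [h1, mobiusApply, smul_smul, ← hP, mul_comm (conj a) c, mul_smul, mul_smul,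
      ← smul_add, ← smul_mul_assoc, ← add_mul]
    congr 1
    rw [← one_mul (Ring.inverse P), ← mul_assoc, mul_one, ← smul_mul_assoc]
    congr 1
    rw [hP]
    module
  have hXW : Commute X (Ring.inverse P) := by
    have h1 : Commute X ((c * (1 - conj a * a)) • Ring.inverse P) := by
      rw [hW]
      exact ((Commute.one_right X).smul_right _).add_right (h.smul_right _)
    have h2 := h1.smul_right (c * (1 - conj a * a))⁻¹
    rwa [inv_smul_smul₀ hne] at h2
  have hXP : Commute X P := by
    have h1 := commute_ringInverse_right (hu.ringInverse) hXW
    rwa [Ring.inverse_inverse hu] at h1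
  have h2 : Commute X (c • (T - a • 1)) := by
    rw [← mobiusApply_mul hu]
    exact h.mul_right hXP
  have h3 := (h2.smul_right c⁻¹).add_right ((Commute.one_right X).smul_right a)
  rwa [inv_smul_smul₀ hc, sub_add_cancel] at h3

/-- `φ(T)` acts on `ker (T - w)` as multiplication by `v = φ(w)`. -/
theorem mobiusApply_of_mem_fibre (hu : IsUnit (1 - conj a • T)) {w : ℂ} {x : H}
    (hx : x ∈ fibre T w) {v : ℂ} (hv : c * (w - a) = v * (1 - conj a * w)) :
    mobiusApply c a T x = v • x := by
  rw [mem_fibre] at hx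
  have hP : (1 - conj a • T) x = (1 - conj a * w) • x := by
    simp [hx, sub_smul, smul_smul]
  rcases eq_or_ne x 0 with rfl | hx0
  · simp
  · have hinv : (1 - conj a * w) • Ring.inverse (1 - conj a • T) x = x := by
      rw [← map_smul, ← hP]
      exact congrArg (fun A : H →L[ℂ] H => A x) (Ring.inverse_mul_cancel _ hu)
    have hne : 1 - conj a * w ≠ 0 := fun h => hx0 (by rw [← hinv, h, zero_smul])
    have hW : Ring.inverse (1 - conj a • T) x = (1 - conj a * w)⁻¹ • x := by
      rw [eq_inv_smul_iff₀ hne, hinv]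
    have hv' : v = c * (w - a) * (1 - conj a * w)⁻¹ := by
      rw [hv, mul_assoc, mul_inv_cancel₀ hne, mul_one]
    simp only [mobiusApply, smul_apply, mul_apply_eq_comp, hW, map_smul, sub_apply, hx,
      one_apply_eq_self, hv']
    module

theorem mobiusApply_conj {D D' : H →L[ℂ] H} (hD : D * D' = 1) (hD' : D' * D = 1)
    (hu : IsUnit (1 - conj a • T)) :
    mobiusApply c a (D' * T * D) = D' * mobiusApply c a T * D := by
  have hP : 1 - conj a • (D' * T * D) = D' * (1 - conj a • T) * D := by
    simp [mul_sub, sub_mul, hD']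
  have hQ : D' * T * D - a • 1 = D' * (T - a • 1) * D := by
    simp [mul_sub, sub_mul, hD']
  obtain ⟨u, hu⟩ := hu
  let δ : (H →L[ℂ] H)ˣ := ⟨D, D', hD, hD'⟩
  have hinv : Ring.inverse (D' * (1 - conj a • T) * D) =
      D' * Ring.inverse (1 - conj a • T) * D := by
    have h1 := Ring.inverse_unit (δ⁻¹ * u * δ)
    rw [← hu, Ring.inverse_unit]
    simpa [mul_assoc, δ] using h1
  rw [mobiusApply, hP, hQ, hinv, mobiusApply, mul_smul_comm, smul_mul_assoc]
  congr 1
  calc _ = D' * (T - a • 1) * (D * D') * Ring.inverse (1 - conj a • T) * D := by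
        simp only [mul_assoc]
    _ = _ := by rw [hD, mul_one]; simp only [mul_assoc]

theorem isUnit_of_spectrum (h : ∀ z ∈ spectrum ℂ T, 1 - conj a * z ≠ 0) :
    IsUnit (1 - conj a • T) := by
  rcases eq_or_ne (conj a) 0 with h0 | h0
  · simp [h0]
  · have h1 : (conj a)⁻¹ ∉ spectrum ℂ T := fun hm => h _ hm (by rw [mul_inv_cancel₀ h0, sub_self])
    rw [spectrum.notMem_iff, Algebra.algebraMap_eq_smul_one] at h1
    have h2 := h1.smul (Units.mk0 _ h0)
    have h3 : Units.mk0 _ h0 • ((conj a)⁻¹ • (1 : H →L[ℂ] H) - T) = 1 - conj a • T := by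
      rw [Units.smul_def, Units.val_mk0, smul_sub, smul_inv_smul₀ h0]
    rwa [h3] at h2

/-- A point `w` off the unit circle can be moved to any nearby point by a transformation
`z ↦ (z - a) / (1 - ā z)` with small `a`: the equation for `a` is real linear with determinant
`1 - |v w|²`. -/
theorem eventually_exists_mobius {w : ℂ} (hw : ‖w‖ ≠ 1) {ε : ℝ} (hε : 0 < ε) :
    ∀ᶠ v in 𝓝 w, ∃ a : ℂ, ‖a‖ < ε ∧ w - a = v * (1 - conj a * w) := by
  let d : ℂ → ℂ := fun v => 1 - (v * w) * conj (v * w)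
  let f : ℂ → ℂ := fun v => ((w - v) + v * w * conj (w - v)) / d v
  have hdw : d w ≠ 0 := by
    refine sub_ne_zero.2 fun h1 => hw ?_
    rw [Complex.mul_conj, Complex.normSq_eq_norm_sq, norm_mul] at h1
    have h2 : (‖w‖ * ‖w‖) ^ 2 = 1 := by exact_mod_cast h1.symm
    have h3 : ‖w‖ ^ 4 = 1 := by rw [← h2]; ring
    exact (pow_eq_one_iff_of_nonneg (norm_nonneg w) (by norm_num)).1 h3
  have hd : Continuous d := by
    simp only [d]; fun_prop
  have hf : ContinuousAt f w := by
    refine ContinuousAt.div ?_ hd.continuousAt hdw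
    exact Continuous.continuousAt (by fun_prop)
  have hf0 : ‖f w‖ < ε := by simpa [f] using hε
  filter_upwards [hf.norm.eventually_lt_const hf0, hd.continuousAt.eventually_ne hdw] with v hv hdv
  refine ⟨f v, hv, ?_⟩
  have hdc : conj (d v) = d v := by
    simp only [d, map_sub, map_one, map_mul, Complex.conj_conj]
    ring
  have hc : conj (f v) = (conj (w - v) + conj (v * w) * (w - v)) / d v := by
    simp only [f, map_div₀, hdc, map_add, map_mul, Complex.conj_conj]
  rw [hc]
  simp only [f]
  field_simp
  simp only [d, map_sub, map_mul]
  ring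

end Moebius

/-! ### Gram determinants of two vectors -/

section GramDet

variable {H : Type*} [NormedAddCommGroup H] [InnerProductSpace ℂ H]

/-- The Gram determinant of two vectors. -/
noncomputable def gramDet (x y : H) : ℂ := inner ℂ x x * inner ℂ y y - inner ℂ x y * inner ℂ y x

theorem gramDet_smul_add (α β δ : ℂ) (x y : H) :
    gramDet (α • x) (β • y + δ • x) = α * conj α * (β * conj β) * gramDet x y := by
  simp only [gramDet, inner_add_left, inner_add_right, inner_smul_left, inner_smul_right]
  ring

theorem gramDet_eq_ofReal (x y : H) :
    gramDet x y = ((‖x‖ ^ 2 * ‖y‖ ^ 2 - ‖inner ℂ x y‖ ^ 2 : ℝ) : ℂ) := by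
  have h : inner ℂ x y * inner ℂ y x = ((‖inner ℂ x y‖ ^ 2 : ℝ) : ℂ) := by
    rw [← inner_conj_symm y x, Complex.mul_conj, Complex.normSq_eq_norm_sq]
  rw [gramDet, h, inner_self_eq_norm_sq_to_K, inner_self_eq_norm_sq_to_K]
  push_cast
  rfl

/-- The strict Cauchy-Schwarz inequality. -/
theorem exists_gramDet_eq_pos {x y : H} (hx : x ≠ 0) (hxy : ∀ c : ℂ, y ≠ c • x) :
    ∃ r : ℝ, 0 < r ∧ gramDet x y = r := by
  refine ⟨_, ?_, gramDet_eq_ofReal x y⟩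
  have hy : y ≠ 0 := fun h => hxy 0 (by simpa using h)
  have hlt : ‖inner ℂ x y‖ < ‖x‖ * ‖y‖ := by
    refine lt_of_le_of_ne (norm_inner_le_norm x y) fun h => ?_
    obtain ⟨r, -, hr⟩ := (norm_inner_eq_norm_iff hx hy).1 h
    exact hxy r hr
  have := norm_nonneg (inner ℂ x y)
  nlinarith

end GramDet

/-! ### A unitary invariant of operators of class `FB_2` -/

section Invariant

variable {H₀ H₁ : Type*} [NormedAddCommGroup H₀] [InnerProductSpace ℂ H₀]
  [NormedAddCommGroup H₁] [InnerProductSpace ℂ H₁]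
  {T₀ : H₀ →L[ℂ] H₀} {S : H₁ →L[ℂ] H₀} {T₁ : H₁ →L[ℂ] H₁} {Ω : Set ℂ}

theorem fst_apply_of_diagonal (U : WithLp 2 (H₀ × H₁) ≃ₗᵢ[ℂ] WithLp 2 (H₀ × H₁))
    (hUr : ∀ y, (U (inrL H₀ H₁ y)).fst = 0) (z : WithLp 2 (H₀ × H₁)) :
    (U z).fst = (U (inlL H₀ H₁ z.fst)).fst := by
  conv_lhs => rw [← inlL_add_inrL z, map_add, WithLp.add_fst, hUr, add_zero]

theorem snd_apply_of_diagonal (U : WithLp 2 (H₀ × H₁) ≃ₗᵢ[ℂ] WithLp 2 (H₀ × H₁))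
    (hUl : ∀ x, (U (inlL H₀ H₁ x)).snd = 0) (z : WithLp 2 (H₀ × H₁)) :
    (U z).snd = (U (inrL H₀ H₁ z.snd)).snd := by
  conv_lhs => rw [← inlL_add_inrL z, map_add, WithLp.add_snd, hUl, zero_add]

/-- A block diagonal unitary operator that maps `ker (T - w)` to `ker (T - v)` preserves the
ratio `gramDet s x / (‖s‖² ‖y‖²)`, where `s` spans `ker (T₀ - w)` and `(x, y)` lies in
`ker (T - w)` with `y ≠ 0`. This is the squared distance of `x` from `ker (T₀ - w)` divided by
`‖y‖²`, which depends on `w` only. -/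
theorem MemFB2.gramDet_mul_eq (hT : MemFB2 Ω T₀ S T₁)
    (U : WithLp 2 (H₀ × H₁) ≃ₗᵢ[ℂ] WithLp 2 (H₀ × H₁))
    (hUl : ∀ x, (U (inlL H₀ H₁ x)).snd = 0) (hUr : ∀ y, (U (inrL H₀ H₁ y)).fst = 0) {w v : ℂ}
    (hv : v ∈ Ω)
    (hU : ∀ z ∈ fibre (upperTriangular T₀ S T₁) w, U z ∈ fibre (upperTriangular T₀ S T₁) v)
    {s : H₀} (hs : s ∈ fibre T₀ w) {z : WithLp 2 (H₀ × H₁)}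
    (hz : z ∈ fibre (upperTriangular T₀ S T₁) w)
    {s' : H₀} (hs' : s' ∈ fibre T₀ v) (hs'0 : s' ≠ 0) {z' : WithLp 2 (H₀ × H₁)}
    (hz' : z' ∈ fibre (upperTriangular T₀ S T₁) v) (hz'0 : z'.snd ≠ 0) :
    gramDet s' z'.fst * (inner ℂ s s * inner ℂ z.snd z.snd) =
      gramDet s z.fst * (inner ℂ s' s' * inner ℂ z'.snd z'.snd) := by
  have hfst : ∀ z, (U z).fst = (U (inlL H₀ H₁ z.fst)).fst :=
    fst_apply_of_diagonal U hUr
  have hsnd : ∀ z, (U z).snd = (U (inrL H₀ H₁ z.snd)).snd :=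
    snd_apply_of_diagonal U hUl
  have hin0 : ∀ x y, inner ℂ (U (inlL H₀ H₁ x)).fst (U (inlL H₀ H₁ y)).fst = inner ℂ x y :=
    fun x y => by
      have := U.inner_map_map (inlL H₀ H₁ x) (inlL H₀ H₁ y)
      rw [WithLp.prod_inner_apply, WithLp.prod_inner_apply] at this
      simpa [hUl] using this
  have hin1 : ∀ x y, inner ℂ (U (inrL H₀ H₁ x)).snd (U (inrL H₀ H₁ y)).snd = inner ℂ x y :=
    fun x y => by
      have := U.inner_map_map (inrL H₀ H₁ x) (inrL H₀ H₁ y)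
      rw [WithLp.prod_inner_apply, WithLp.prod_inner_apply] at this
      simpa [hUr] using this
  have hs2 : (U (inlL H₀ H₁ s)).fst ∈ fibre T₀ v := by
    have h1 : inlL H₀ H₁ s ∈ fibre (upperTriangular T₀ S T₁) w := by
      rw [mem_fibre] at hs
      rw [mem_fibre_upperTriangular]
      simp [hs]
    have h2 := (mem_fibre_upperTriangular.1 (hU _ h1)).1
    rw [hUl, map_zero, add_zero] at h2
    exact mem_fibre.2 h2
  obtain ⟨α, hα⟩ := hT.memB_left.exists_smul_eq hv hs' hs'0 hs2
  obtain ⟨hz2, hz3⟩ := mem_fibre_upperTriangular.1 (hU _ hz)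
  obtain ⟨hz2', hz3'⟩ := mem_fibre_upperTriangular.1 hz'
  obtain ⟨β, hβ⟩ := hT.memB_right.exists_smul_eq hv (mem_fibre.2 hz3') hz'0 (mem_fibre.2 hz3)
  have hdiff : (U z).fst - β • z'.fst ∈ fibre T₀ v := by
    rw [mem_fibre, map_sub, map_smul, eq_sub_of_add_eq hz2, eq_sub_of_add_eq hz2', hβ, map_smul]
    module
  obtain ⟨δ, hδ⟩ := hT.memB_left.exists_smul_eq hv hs' hs'0 hdiff
  have hUz : (U z).fst = β • z'.fst + δ • s' := by rw [← hδ]; abel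
  have hg : gramDet s z.fst = gramDet (U (inlL H₀ H₁ s)).fst (U z).fst := by
    rw [hfst z]; simp only [gramDet, hin0]
  have hs1 : inner ℂ s s = α * conj α * inner ℂ s' s' := by
    rw [← hin0 s s, hα, inner_smul_left, inner_smul_right]; ring
  have hy1 : inner ℂ z.snd z.snd = β * conj β * inner ℂ z'.snd z'.snd := by
    rw [← hin1 z.snd z.snd, ← hsnd, hβ, inner_smul_left, inner_smul_right]; ring
  rw [hg, hα, hUz, gramDet_smul_add, hs1, hy1]
  ring

end Invariant

/-! ### Block diagonal intertwiners and homogeneity -/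

section Homogeneous

variable {H₀ H₁ : Type*} [NormedAddCommGroup H₀] [InnerProductSpace ℂ H₀] [CompleteSpace H₀]
  [NormedAddCommGroup H₁] [InnerProductSpace ℂ H₁] [CompleteSpace H₁]
  {T₀ : H₀ →L[ℂ] H₀} {S : H₁ →L[ℂ] H₀} {T₁ : H₁ →L[ℂ] H₁} {Ω : Set ℂ}

/-- Rigidity of the flag structure: a unitary operator that intertwines `φ(T)` and `T` is block
diagonal. -/
theorem MemFB2.diagonal_of_intertwines (hΩ : IsOpen Ω) (hΩc : IsPreconnected Ω)
    (hT : MemFB2 Ω T₀ S T₁) {c a : ℂ} (hc : c ≠ 0) (ha : ‖a‖ < 1)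
    (hu : IsUnit (1 - conj a • upperTriangular T₀ S T₁))
    (U : WithLp 2 (H₀ × H₁) ≃ₗᵢ[ℂ] WithLp 2 (H₀ × H₁))
    (hU : ∀ z, U (mobiusApply c a (upperTriangular T₀ S T₁) z) = upperTriangular T₀ S T₁ (U z)) :
    (∀ x, (U (inlL H₀ H₁ x)).snd = 0) ∧ ∀ y, (U (inrL H₀ H₁ y)).fst = 0 := by
  set T := upperTriangular T₀ S T₁ with hTdef
  let u : WithLp 2 (H₀ × H₁) →L[ℂ] WithLp 2 (H₀ × H₁) := U.toContinuousLinearEquiv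
  let v : WithLp 2 (H₀ × H₁) →L[ℂ] WithLp 2 (H₀ × H₁) := U.symm.toContinuousLinearEquiv
  have hvu : v * u = 1 := by ext1 z; exact U.symm_apply_apply z
  have huv : u * v = 1 := by ext1 z; exact U.apply_symm_apply z
  have hu1 : u * mobiusApply c a T = T * u := by ext1 z; exact hU z
  have hv1 : v * T = mobiusApply c a T * v := by
    calc v * T = v * (T * u) * v := by rw [mul_assoc, mul_assoc, huv, mul_one]
      _ = v * u * mobiusApply c a T * v := by rw [← hu1]; simp only [mul_assoc]
      _ = _ := by rw [hvu, one_mul]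
  have hNT : Commute (upperTriangular 0 S 0) T := hT.commute_corner
  have hN := commute_mobiusApply (c := c) hu hNT
  set N : WithLp 2 (H₀ × H₁) →L[ℂ] WithLp 2 (H₀ × H₁) := upperTriangular 0 S 0
  have h1 : Commute (u * N * v) T := by
    change u * N * v * T = T * (u * N * v)
    rw [mul_assoc, hv1, ← mul_assoc, mul_assoc u, hN.eq, ← mul_assoc u, hu1]
    simp only [mul_assoc]
  have h2 : Commute (v * N * u) T := by
    refine commute_of_commute_mobiusApply hu hc ha ?_
    change v * N * u * mobiusApply c a T = mobiusApply c a T * (v * N * u)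
    rw [mul_assoc, hu1, ← mul_assoc, mul_assoc v, hNT.eq, ← mul_assoc v, hv1]
    simp only [mul_assoc]
  have hUl : ∀ x, (U (inlL H₀ H₁ x)).snd = 0 := hT.snd_eq_zero_of_commute_conj hΩ hΩc hvu h1
  have hVl : ∀ x, (U.symm (inlL H₀ H₁ x)).snd = 0 :=
    hT.snd_eq_zero_of_commute_conj hΩ hΩc huv h2
  refine ⟨hUl, fun y => ?_⟩
  -- `U⁻¹ = U*` preserves the first summand, so `U` preserves its orthogonal complement.
  have h3 : ∀ x, inner ℂ x (U (inrL H₀ H₁ y)).fst = 0 := fun x => by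
    have h4 := U.symm.inner_map_map (inlL H₀ H₁ x) (U (inrL H₀ H₁ y))
    rw [U.symm_apply_apply, WithLp.prod_inner_apply, WithLp.prod_inner_apply] at h4
    simpa [hVl x] using h4.symm
  exact inner_self_eq_zero.1 (h3 _)

/-- For a homogeneous operator in `FB_2(Ω)`, the ratio `gramDet s x / (‖s‖² ‖y‖²)` is locally
constant off the unit circle. -/
theorem MemFB2.eventually_gramDet_mul_eq (hΩ : IsOpen Ω) (hΩc : IsPreconnected Ω)
    (hT : MemFB2 Ω T₀ S T₁) (hhom : IsHomogeneous (upperTriangular T₀ S T₁))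
    {w : ℂ} (hw : w ∈ Ω) (hw1 : ‖w‖ ≠ 1)
    {s : H₀} (hs : s ∈ fibre T₀ w) {z : WithLp 2 (H₀ × H₁)}
    (hz : z ∈ fibre (upperTriangular T₀ S T₁) w) :
    ∀ᶠ v in 𝓝 w, ∀ s' ∈ fibre T₀ v, s' ≠ 0 → ∀ z' ∈ fibre (upperTriangular T₀ S T₁) v,
      z'.snd ≠ 0 → gramDet s' z'.fst * (inner ℂ s s * inner ℂ z.snd z.snd) =
        gramDet s z.fst * (inner ℂ s' s' * inner ℂ z'.snd z'.snd) := by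
  set T := upperTriangular T₀ S T₁
  have hε : 0 < min 1 (‖T‖ + 1)⁻¹ := by positivity
  filter_upwards [eventually_exists_mobius hw1 hε, hΩ.mem_nhds hw] with v ⟨a, ha, hav⟩ hv
  have ha1 : ‖a‖ < 1 := ha.trans_le (min_le_left _ _)
  have ha2 : ‖a‖ < (‖T‖ + 1)⁻¹ := ha.trans_le (min_le_right _ _)
  have hspec : ∀ z ∈ spectrum ℂ T, 1 - conj a * z ≠ 0 := by
    intro z hz h0
    have h1 : ‖z‖ ≤ ‖T‖ * 1 :=
      (spectrum.norm_le_norm_mul_of_mem hz).trans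
        (by gcongr; exact ContinuousLinearMap.norm_id_le)
    have h2 : ‖a‖ * ‖z‖ = 1 := by
      have := congrArg norm (sub_eq_zero.1 h0)
      rw [norm_mul, RCLike.norm_conj, norm_one] at this
      exact this.symm
    have h3 : 0 < ‖a‖ := by
      by_contra h
      have : ‖a‖ = 0 := le_antisymm (not_lt.1 h) (norm_nonneg a)
      rw [this, zero_mul] at h2
      exact zero_ne_one h2
    rw [lt_inv_comm₀ h3 (by positivity)] at ha2
    have h4 : ‖z‖ = ‖a‖⁻¹ := eq_inv_of_mul_eq_one_right h2
    linarith
  have hu := isUnit_of_spectrum hspec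
  obtain ⟨U, hU⟩ := hhom 1 a norm_one ha1 hspec
  obtain ⟨hUl, hUr⟩ := hT.diagonal_of_intertwines hΩ hΩc one_ne_zero ha1 hu U hU
  intro s' hs' hs'0 z' hz' hz'0
  refine hT.gramDet_mul_eq U hUl hUr hv (fun x hx => ?_) hs hz hs' hs'0 hz' hz'0
  rw [mem_fibre, ← hU, mobiusApply_of_mem_fibre hu hx (v := v) (by rw [one_mul, hav]), map_smul]

/-- Homogeneity of `(T₀, S; 0, T₁)` passes to `(T₀, g S; 0, T₁)` for a nonzero constant `g`: the
two are similar through `(1, 0; 0, g)`, which commutes with the block diagonal unitary operators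
that intertwine `φ(T)` and `T`. -/
theorem MemFB2.isHomogeneous_smul (hΩ : IsOpen Ω) (hΩc : IsPreconnected Ω)
    (hT : MemFB2 Ω T₀ S T₁) (hhom : IsHomogeneous (upperTriangular T₀ S T₁)) {g : ℂ}
    (hg : g ≠ 0) : IsHomogeneous (upperTriangular T₀ (g • S) T₁) := by
  set T := upperTriangular T₀ S T₁
  let e := blockDiagonal (ContinuousLinearEquiv.refl ℂ H₀)
    (ContinuousLinearEquiv.smulLeft (R₁ := ℂ) (M₁ := H₁) (Units.mk0 g hg))
  let D : WithLp 2 (H₀ × H₁) →L[ℂ] WithLp 2 (H₀ × H₁) := e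
  let D' : WithLp 2 (H₀ × H₁) →L[ℂ] WithLp 2 (H₀ × H₁) := e.symm
  have hDD' : D * D' = 1 := by ext1 z; exact e.apply_symm_apply z
  have hD'D : D' * D = 1 := by ext1 z; exact e.symm_apply_apply z
  have hDfst : ∀ z, (D z).fst = z.fst :=
    fun z => rfl
  have hDsnd : ∀ z, (D z).snd = g • z.snd :=
    fun z => rfl
  have hDT : upperTriangular T₀ (g • S) T₁ = D' * T * D := by
    have h1 : D * upperTriangular T₀ (g • S) T₁ = T * D := by
      ext z
      refine block_ext ?_ ?_
      · simp [hDfst, hDsnd, T]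
      · simp [hDsnd, T]
    rw [mul_assoc, ← h1, ← mul_assoc, hD'D, one_mul]
  intro c a hc ha hspec
  rw [hDT] at hspec ⊢
  have hsp : spectrum ℂ (D' * T * D) = spectrum ℂ T := 
    spectrum.units_conjugate' (u := ⟨D, D', hDD', hD'D⟩)
  rw [hsp] at hspec
  have hu := isUnit_of_spectrum hspec
  obtain ⟨U, hU⟩ := hhom c a hc ha hspec
  have hc0 : c ≠ 0 := fun h => by simp [h] at hc
  obtain ⟨hUl, hUr⟩ := hT.diagonal_of_intertwines hΩ hΩc hc0 ha hu U hU
  have hfst : ∀ z, (U z).fst = (U (inlL H₀ H₁ z.fst)).fst :=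
    fst_apply_of_diagonal U hUr
  have hsnd : ∀ z, (U z).snd = (U (inrL H₀ H₁ z.snd)).snd :=
    snd_apply_of_diagonal U hUl
  let u : WithLp 2 (H₀ × H₁) →L[ℂ] WithLp 2 (H₀ × H₁) := U.toContinuousLinearEquiv
  have hDu : Commute D u := by
    ext z
    refine block_ext ?_ ?_
    · change (U z).fst = (U (D z)).fst
      rw [hfst, hfst (D z), hDfst]
    · change g • (U z).snd = (U (D z)).snd
      rw [hsnd, hsnd (D z), hDsnd, map_smul, map_smul, WithLp.smul_snd]
  have hDu' : Commute D' u := by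
    calc D' * u = D' * (u * D) * D' := by rw [mul_assoc, mul_assoc, hDD', mul_one]
      _ = D' * D * u * D' := by rw [← hDu.eq]; simp only [mul_assoc]
      _ = u * D' := by rw [hD'D, one_mul]
  have hu1 : u * mobiusApply c a T = T * u := by ext1 z; exact hU z
  have hfinal : u * mobiusApply c a (D' * T * D) = D' * T * D * u := by
    rw [mobiusApply_conj hDD' hD'D hu]
    calc u * (D' * mobiusApply c a T * D) = u * D' * mobiusApply c a T * D := by
          simp only [mul_assoc]
      _ = D' * (u * mobiusApply c a T) * D := by rw [← hDu'.eq]; simp only [mul_assoc]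
      _ = D' * T * (u * D) := by rw [hu1]; simp only [mul_assoc]
      _ = D' * T * D * u := by rw [← hDu.eq]; simp only [mul_assoc]
  exact ⟨U, fun z => congrArg (fun A : WithLp 2 (H₀ × H₁) →L[ℂ] WithLp 2 (H₀ × H₁) => A z) hfinal⟩

end Homogeneous

/-! ### Wirtinger calculus -/

section Wirtinger

variable {f g : ℂ → ℂ} {w : ℂ}

theorem wirtinger_congr (h : f =ᶠ[𝓝 w] g) : wirtinger f w = wirtinger g w := by
  rw [wirtinger, wirtinger, h.fderiv_eq]

theorem wirtingerBar_congr (h : f =ᶠ[𝓝 w] g) : wirtingerBar f w = wirtingerBar g w := by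
  rw [wirtingerBar, wirtingerBar, h.fderiv_eq]

theorem wirtinger_add (hf : DifferentiableAt ℝ f w) (hg : DifferentiableAt ℝ g w) :
    wirtinger (fun z => f z + g z) w = wirtinger f w + wirtinger g w := by
  simp only [wirtinger, fderiv_fun_add hf hg, add_apply]
  ring

theorem wirtingerBar_add (hf : DifferentiableAt ℝ f w) (hg : DifferentiableAt ℝ g w) :
    wirtingerBar (fun z => f z + g z) w = wirtingerBar f w + wirtingerBar g w := by
  simp only [wirtingerBar, fderiv_fun_add hf hg, add_apply]
  ring

theorem wirtinger_sub (hf : DifferentiableAt ℝ f w) (hg : DifferentiableAt ℝ g w) :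
    wirtinger (fun z => f z - g z) w = wirtinger f w - wirtinger g w := by
  simp only [wirtinger, fderiv_fun_sub hf hg, sub_apply]
  ring

theorem wirtinger_mul (hf : DifferentiableAt ℝ f w) (hg : DifferentiableAt ℝ g w) :
    wirtinger (fun z => f z * g z) w = wirtinger f w * g w + f w * wirtinger g w := by
  simp only [wirtinger, fderiv_fun_mul hf hg, add_apply, smul_apply, smul_eq_mul]
  ring

theorem wirtingerBar_mul (hf : DifferentiableAt ℝ f w) (hg : DifferentiableAt ℝ g w) :
    wirtingerBar (fun z => f z * g z) w = wirtingerBar f w * g w + f w * wirtingerBar g w := by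
  simp only [wirtingerBar, fderiv_fun_mul hf hg, add_apply, smul_apply, smul_eq_mul]
  ring

theorem differentiableAt_real_div (hf : DifferentiableAt ℝ f w) (hg : DifferentiableAt ℝ g w)
    (h0 : g w ≠ 0) : DifferentiableAt ℝ (fun z => f z / g z) w := by
  simp only [div_eq_mul_inv]
  exact hf.fun_mul (hg.fun_inv h0)

theorem wirtingerBar_div (hf : DifferentiableAt ℝ f w) (hg : DifferentiableAt ℝ g w)
    (h0 : g w ≠ 0) :
    wirtingerBar (fun z => f z / g z) w =
      (wirtingerBar f w * g w - f w * wirtingerBar g w) / g w ^ 2 := by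
  have hq : DifferentiableAt ℝ (fun z => f z / g z) w := differentiableAt_real_div hf hg h0
  have h1 : f =ᶠ[𝓝 w] fun z => f z / g z * g z := by
    filter_upwards [hg.continuousAt.eventually_ne h0] with z hz
    rw [div_mul_cancel₀ _ hz]
  have h2 := wirtingerBar_congr h1
  rw [wirtingerBar_mul hq hg] at h2
  rw [h2]
  field_simp
  ring

theorem fderiv_real_apply (hf : DifferentiableAt ℂ f w) (v : ℂ) :
    fderiv ℝ f w v = v * deriv f w := by
  rw [hf.fderiv_restrictScalars ℝ]
  simp [ContinuousLinearMap.coe_restrictScalars', fderiv_eq_smul_deriv]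

theorem wirtinger_of_differentiableAt (hf : DifferentiableAt ℂ f w) :
    wirtinger f w = deriv f w := by
  rw [wirtinger, fderiv_real_apply hf, fderiv_real_apply hf, ← mul_assoc, Complex.I_mul_I]
  ring

theorem wirtingerBar_of_differentiableAt (hf : DifferentiableAt ℂ f w) :
    wirtingerBar f w = 0 := by
  rw [wirtingerBar, fderiv_real_apply hf, fderiv_real_apply hf, ← mul_assoc, Complex.I_mul_I]
  ring

theorem fderiv_conj_apply (f : ℂ → ℂ) (w v : ℂ) :
    fderiv ℝ (fun z => conj (f z)) w v = conj (fderiv ℝ f w v) := by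
  have := Complex.conjCLE.comp_fderiv (f := f) (x := w)
  exact congrArg (fun A : ℂ →L[ℝ] ℂ => A v) this

theorem wirtinger_conj (f : ℂ → ℂ) (w : ℂ) :
    wirtinger (fun z => conj (f z)) w = conj (wirtingerBar f w) := by
  simp only [wirtinger, wirtingerBar, fderiv_conj_apply, map_div₀, map_add, map_mul, Complex.conj_I,
    Complex.conj_ofNat]
  ring

theorem wirtingerBar_conj (f : ℂ → ℂ) (w : ℂ) :
    wirtingerBar (fun z => conj (f z)) w = conj (wirtinger f w) := by
  simp only [wirtinger, wirtingerBar, fderiv_conj_apply, map_div₀, map_sub, map_mul, Complex.conj_I,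
    Complex.conj_ofNat]
  ring

theorem differentiableAt_conj (hf : DifferentiableAt ℝ f w) :
    DifferentiableAt ℝ (fun z => conj (f z)) w :=
  Complex.conjCLE.differentiableAt.comp w hf

theorem differentiableAt_wirtinger (hf : ContDiffAt ℝ 2 f w) :
    DifferentiableAt ℝ (wirtinger f) w := by
  have h1 : ContDiffAt ℝ 1 (fderiv ℝ f) w := hf.fderiv_right (by norm_num)
  have h2 : DifferentiableAt ℝ (fderiv ℝ f) w := h1.differentiableAt (by norm_num)
  have h3 : ∀ v : ℂ, DifferentiableAt ℝ (fun z => fderiv ℝ f z v) w := fun v =>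
    h2.clm_apply (differentiableAt_const v)
  have h4 : wirtinger f =
      fun z => (fderiv ℝ f z 1 - Complex.I * fderiv ℝ f z Complex.I) * (2 : ℂ)⁻¹ := by
    funext z
    rw [wirtinger, div_eq_mul_inv]
  rw [h4]
  exact ((h3 1).fun_sub ((differentiableAt_const _).fun_mul (h3 _))).mul_const _

theorem eventually_differentiableAt (hf : ContDiffAt ℝ 2 f w) :
    ∀ᶠ z in 𝓝 w, DifferentiableAt ℝ f z :=
  (hf.eventually (by simp)).mono fun _ h => h.differentiableAt (by norm_num)

/-- The expression `∂/∂w̄ ((∂d/∂w) / d)`, which is `∂²/∂w̄∂w log d` for a positive function `d`. -/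
noncomputable def logCurv (d : ℂ → ℂ) (w : ℂ) : ℂ := wirtingerBar (fun z => wirtinger d z / d z) w

theorem logCurv_congr (h : f =ᶠ[𝓝 w] g) : logCurv f w = logCurv g w := by
  refine wirtingerBar_congr ?_
  filter_upwards [h.eventually_nhds] with z hz
  rw [wirtinger_congr hz, hz.self_of_nhds]

theorem logCurv_mul (hf : ContDiffAt ℝ 2 f w) (hg : ContDiffAt ℝ 2 g w) (hf0 : f w ≠ 0)
    (hg0 : g w ≠ 0) : logCurv (fun z => f z * g z) w = logCurv f w + logCurv g w := by
  rw [logCurv, logCurv, logCurv, ← wirtingerBar_add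
    (differentiableAt_real_div (differentiableAt_wirtinger hf)
      (hf.differentiableAt (by norm_num)) hf0)
    (differentiableAt_real_div (differentiableAt_wirtinger hg)
      (hg.differentiableAt (by norm_num)) hg0)]
  refine wirtingerBar_congr ?_
  filter_upwards [eventually_differentiableAt hf,
    eventually_differentiableAt hg, hf.continuousAt.eventually_ne hf0,
    hg.continuousAt.eventually_ne hg0] with z h1 h2 h3 h4
  rw [wirtinger_mul h1 h2]
  field_simp

/-- `log |a|²` is harmonic for a nonvanishing holomorphic function `a`. -/
theorem logCurv_mul_conj {a : ℂ → ℂ} (ha : AnalyticAt ℂ a w) (ha0 : a w ≠ 0) :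
    logCurv (fun z => a z * conj (a z)) w = 0 := by
  have h : (fun z => wirtinger (fun z => a z * conj (a z)) z / (a z * conj (a z))) =ᶠ[𝓝 w]
      fun z => deriv a z / a z := by
    filter_upwards [ha.eventually_analyticAt, ha.continuousAt.eventually_ne ha0] with z hz hz0
    have hzd := hz.differentiableAt
    have hzr := hzd.restrictScalars ℝ
    rw [wirtinger_mul hzr (differentiableAt_conj hzr), wirtinger_conj,
      wirtingerBar_of_differentiableAt hzd, wirtinger_of_differentiableAt hzd]
    have : conj (a z) ≠ 0 := by simpa using hz0
    field_simp
    simp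
  rw [logCurv, wirtingerBar_congr h, wirtingerBar_of_differentiableAt]
  exact ha.deriv.differentiableAt.fun_div ha.differentiableAt ha0

/-- The value is nonnegative, and zero only at the critical points of `a`. -/
theorem logCurv_one_add {a : ℂ → ℂ} (ha : AnalyticAt ℂ a w) {r : ℝ} (hr : 0 < r) :
    logCurv (fun z => 1 + r * (a z * conj (a z))) w =
      r * (deriv a w * conj (deriv a w)) / (1 + r * (a w * conj (a w))) ^ 2 := by
  have hne : ∀ z, (1 : ℂ) + r * (a z * conj (a z)) ≠ 0 := fun z => by
    rw [Complex.mul_conj]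
    have : (0 : ℝ) < 1 + r * Complex.normSq (a z) := by
      have := Complex.normSq_nonneg (a z)
      positivity
    exact_mod_cast this.ne'
  have hcalc : ∀ z, AnalyticAt ℂ a z →
      DifferentiableAt ℝ (fun z => 1 + r * (a z * conj (a z))) z ∧
      wirtinger (fun z => 1 + r * (a z * conj (a z))) z = r * (deriv a z * conj (a z)) ∧
      wirtingerBar (fun z => 1 + r * (a z * conj (a z))) z = r * (a z * conj (deriv a z)) := by
    intro z hz
    have hzd := hz.differentiableAt
    have hzr := hzd.restrictScalars ℝ
    have hc := differentiableAt_conj hzr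
    have hm := hzr.fun_mul hc
    have hk : DifferentiableAt ℝ (fun _ : ℂ => (r : ℂ)) z := differentiableAt_const _
    have h1 : DifferentiableAt ℝ (fun _ : ℂ => (1 : ℂ)) z := differentiableAt_const _
    refine ⟨h1.fun_add (hk.fun_mul hm), ?_, ?_⟩
    · rw [wirtinger_add h1 (hk.fun_mul hm), wirtinger_mul hk hm, wirtinger_mul hzr hc,
        wirtinger_conj, wirtingerBar_of_differentiableAt hzd, wirtinger_of_differentiableAt hzd,
        wirtinger_of_differentiableAt (differentiableAt_const _),
        wirtinger_of_differentiableAt (differentiableAt_const _)]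
      simp
    · rw [wirtingerBar_add h1 (hk.fun_mul hm), wirtingerBar_mul hk hm, wirtingerBar_mul hzr hc,
        wirtingerBar_conj, wirtingerBar_of_differentiableAt hzd, wirtinger_of_differentiableAt hzd,
        wirtingerBar_of_differentiableAt (differentiableAt_const _),
        wirtingerBar_of_differentiableAt (differentiableAt_const _)]
      simp
  have h : (fun z => wirtinger (fun z => 1 + r * (a z * conj (a z))) z /
      (1 + r * (a z * conj (a z)))) =ᶠ[𝓝 w]
      fun z => (r * (deriv a z * conj (a z))) / (1 + r * (a z * conj (a z))) := by
    filter_upwards [ha.eventually_analyticAt] with z hz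
    rw [(hcalc z hz).2.1]
  have hd := ha.differentiableAt
  have hr' := differentiableAt_conj (hd.restrictScalars ℝ)
  have hd' := ha.deriv.differentiableAt
  have hdr := hd'.restrictScalars ℝ
  have hk : DifferentiableAt ℝ (fun _ : ℂ => (r : ℂ)) w := differentiableAt_const _
  rw [logCurv, wirtingerBar_congr h,
    wirtingerBar_div (hk.fun_mul (hdr.fun_mul hr')) (hcalc w ha).1 (hne w), (hcalc w ha).2.2,
    wirtingerBar_mul hk (hdr.fun_mul hr'), wirtingerBar_mul hdr hr', wirtingerBar_conj,
    wirtingerBar_of_differentiableAt hd', wirtinger_of_differentiableAt hd,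
    wirtingerBar_of_differentiableAt (differentiableAt_const _)]
  congr 1
  ring

end Wirtinger

/-! ### Curvature and holomorphic frames -/

section Frames

variable {H : Type*} [NormedAddCommGroup H] [InnerProductSpace ℂ H] {T : H →L[ℂ] H} {w : ℂ}

theorem contDiffAt_inner [CompleteSpace H] {f g : ℂ → H} {V : Set ℂ} (hV : IsOpen V) (hw : w ∈ V)
    (hf : DifferentiableOn ℂ f V) (hg : DifferentiableOn ℂ g V) :
    ContDiffAt ℝ 2 (fun z => inner ℂ (f z) (g z)) w :=
  (((hf.contDiffOn hV).contDiffAt (hV.mem_nhds hw)).restrict_scalars ℝ).inner ℂ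
    (((hg.contDiffOn hV).contDiffAt (hV.mem_nhds hw)).restrict_scalars ℝ)

open scoped ComplexOrder in
theorem det_gramMatrix_ne_zero {n : ℕ} {γ : Fin n → ℂ → H} {z : ℂ}
    (h : LinearIndependent ℂ fun i => γ i z) : (gramMatrix γ z).det ≠ 0 :=
  (Matrix.posDef_gram_of_linearIndependent (𝕜 := ℂ) h).det_pos.ne'

theorem IsFrameAt.det_gramMatrix_ne_zero {n : ℕ} {γ : Fin n → ℂ → H} (hγ : IsFrameAt T w γ) :
    (gramMatrix γ w).det ≠ 0 := by
  obtain ⟨V, -, hw, -, h⟩ := hγ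
  exact CowenDouglas.det_gramMatrix_ne_zero (h w hw).1

/-- The Gram determinants of two holomorphic frames of the same bundle differ by the squared
modulus of a nonvanishing holomorphic function, the determinant of the change of frame. -/
theorem IsFrameAt.exists_det_gramMatrix_eq {n : ℕ} {γ γ' : Fin n → ℂ → H} (hγ : IsFrameAt T w γ)
    (hγ' : IsFrameAt T w γ') : ∃ a : ℂ → ℂ, AnalyticAt ℂ a w ∧ a w ≠ 0 ∧
      (fun z => (gramMatrix γ' z).det) =ᶠ[𝓝 w]
        fun z => (a z * conj (a z)) * (gramMatrix γ z).det := by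
  have hdet' := hγ'.det_gramMatrix_ne_zero
  have hdet := hγ.det_gramMatrix_ne_zero
  obtain ⟨V, hV, hwV, hd, hs⟩ := hγ
  obtain ⟨V', hV', hwV', hd', hs'⟩ := hγ'
  -- Pairing with the fixed vectors `γ i w` expresses the change of frame holomorphically.
  let M : (Fin n → ℂ → H) → ℂ → Matrix (Fin n) (Fin n) ℂ := fun β z =>
    Matrix.of fun i j => inner ℂ (γ i w) (β j z)
  have hMd : ∀ (β : Fin n → ℂ → H) (z : ℂ), (∀ j, DifferentiableAt ℂ (β j) z) →
      DifferentiableAt ℂ (fun z => (M β z).det) z := by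
    intro β z hβ
    simp only [Matrix.det_apply]
    refine DifferentiableAt.fun_sum fun σ _ => DifferentiableAt.fun_const_smul ?_ _
    refine DifferentiableAt.fun_finsetProd fun i _ => ?_
    exact (innerSL ℂ (γ (σ i) w)).differentiableAt.comp z (hβ i)
  have hW : IsOpen (V ∩ V') := hV.inter hV'
  have hwW : w ∈ V ∩ V' := ⟨hwV, hwV'⟩
  have hM : ∀ z ∈ V ∩ V', DifferentiableAt ℂ (fun z => (M γ z).det) z := fun z hz =>
    hMd γ z fun j => (hd j).differentiableAt (hV.mem_nhds hz.1)
  have hM' : ∀ z ∈ V ∩ V', DifferentiableAt ℂ (fun z => (M γ' z).det) z := fun z hz =>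
    hMd γ' z fun j => (hd' j).differentiableAt (hV'.mem_nhds hz.2)
  have hMw : (M γ w).det ≠ 0 := hdet
  have heq : (fun z => (gramMatrix γ' z).det) =ᶠ[𝓝 w] fun z =>
      ((M γ' z).det / (M γ z).det * conj ((M γ' z).det / (M γ z).det)) *
        (gramMatrix γ z).det := by
    filter_upwards [hW.mem_nhds hwW, (hM w hwW).continuousAt.eventually_ne hMw] with z hz hz0
    have hmem : ∀ j, ∃ c : Fin n → ℂ, ∑ k, c k • γ k z = γ' j z := fun j => by
      rw [← Submodule.mem_span_range_iff_exists_fun, (hs z hz.1).2, ← (hs' z hz.2).2]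
      exact Submodule.subset_span ⟨j, rfl⟩
    choose c hc using hmem
    let A : Matrix (Fin n) (Fin n) ℂ := Matrix.of fun k j => c j k
    have h1 : M γ' z = M γ z * A := by
      ext i j
      simp only [M, Matrix.mul_apply, Matrix.of_apply, A, ← hc j, inner_sum, inner_smul_right]
      exact Finset.sum_congr rfl fun k _ => mul_comm _ _
    have h2 : gramMatrix γ' z = A.conjTranspose * gramMatrix γ z * A := by
      ext i j
      simp only [gramMatrix, Matrix.mul_apply, Matrix.of_apply, A, ← hc, inner_sum, sum_inner,
        inner_smul_right, inner_smul_left, Matrix.conjTranspose_apply,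
        RCLike.star_def]
      exact Finset.sum_congr rfl fun k _ => mul_comm _ _
    have h3 : (M γ' z).det / (M γ z).det = A.det := by
      rw [h1, Matrix.det_mul, mul_div_cancel_left₀ _ hz0]
    rw [h3, h2, Matrix.det_mul, Matrix.det_mul, Matrix.det_conjTranspose, RCLike.star_def]
    ring
  refine ⟨fun z => (M γ' z).det / (M γ z).det, ?_, ?_, heq⟩
  · have h1 : AnalyticAt ℂ (fun z => (M γ' z).det) w :=
      DifferentiableOn.analyticAt (fun z hz => (hM' z hz).differentiableWithinAt)
        (hW.mem_nhds hwW)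
    have h2 : AnalyticAt ℂ (fun z => (M γ z).det) w :=
      DifferentiableOn.analyticAt (fun z hz => (hM z hz).differentiableWithinAt)
        (hW.mem_nhds hwW)
    exact h1.fun_div h2 hMw
  · intro h0
    have := heq.self_of_nhds
    simp only [h0, zero_mul] at this
    exact hdet' this

theorem IsFrameAt.gramMatrix_contDiffAt [CompleteSpace H] {n : ℕ} {γ : Fin n → ℂ → H}
    (hγ : IsFrameAt T w γ) (i j : Fin n) : ContDiffAt ℝ 2 (fun z => gramMatrix γ z i j) w := by
  obtain ⟨V, hV, hwV, hd, -⟩ := hγ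
  exact contDiffAt_inner hV hwV (hd i) (hd j)

theorem IsFrameAt.det_gramMatrix_contDiffAt [CompleteSpace H] {n : ℕ} {γ : Fin n → ℂ → H}
    (hγ : IsFrameAt T w γ) : ContDiffAt ℝ 2 (fun z => (gramMatrix γ z).det) w := by
  simp only [Matrix.det_apply]
  refine ContDiffAt.sum fun σ _ => ContDiffAt.const_smul _ ?_
  exact contDiffAt_prod fun i _ => hγ.gramMatrix_contDiffAt _ _

/-- The curvature expression does not depend on the frame. -/
theorem IsFrameAt.logCurv_eq [CompleteSpace H] {n : ℕ} {γ γ' : Fin n → ℂ → H}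
    (hγ : IsFrameAt T w γ) (hγ' : IsFrameAt T w γ') :
    logCurv (fun z => (gramMatrix γ' z).det) w = logCurv (fun z => (gramMatrix γ z).det) w := by
  obtain ⟨a, ha, ha0, heq⟩ := hγ.exists_det_gramMatrix_eq hγ'
  have hac : ContDiffAt ℝ 2 a w := ha.contDiffAt.restrict_scalars ℝ
  have hac' : ContDiffAt ℝ 2 (fun z => conj (a z)) w :=
    Complex.conjCLE.contDiff.contDiffAt.comp w hac
  rw [logCurv_congr heq, logCurv_mul (hac.mul hac') (hγ.det_gramMatrix_contDiffAt)
    (by simpa using ha0) (hγ.det_gramMatrix_ne_zero), logCurv_mul_conj ha ha0, zero_add]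

/-- In rank one the trace formula holds by definition. -/
theorem trace_curvatureMatrix_one (γ : Fin 1 → ℂ → H) (w : ℂ) :
    (curvatureMatrix γ w).trace = -logCurv (fun z => (gramMatrix γ z).det) w := by
  simp [curvatureMatrix, logCurv, Matrix.trace, Matrix.mul_apply, div_eq_inv_mul]

/-- Jacobi's formula `tr (h⁻¹ ∂h/∂w) = (∂ det h/∂w) / det h`, differentiated. -/
theorem trace_curvatureMatrix_two [CompleteSpace H] {γ : Fin 2 → ℂ → H} (hγ : IsFrameAt T w γ) :
    (curvatureMatrix γ w).trace = -logCurv (fun z => (gramMatrix γ z).det) w := by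
  have hc := hγ.gramMatrix_contDiffAt
  have hdw : ∀ i j, DifferentiableAt ℝ (wirtinger fun u => gramMatrix γ u i j) w := fun i j =>
    differentiableAt_wirtinger (hc i j)
  have hd : ∀ i j, DifferentiableAt ℝ (fun z => gramMatrix γ z i j) w := fun i j =>
    (hc i j).differentiableAt (by norm_num)
  have hdet : DifferentiableAt ℝ (fun z => (gramMatrix γ z).det) w :=
    (hγ.det_gramMatrix_contDiffAt).differentiableAt (by norm_num)
  have h0 := hγ.det_gramMatrix_ne_zero
  have hinv : DifferentiableAt ℝ (fun z => (gramMatrix γ z).det⁻¹) w := hdet.fun_inv h0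
  have e0 : ∀ z, ((gramMatrix γ z)⁻¹ *
      Matrix.of fun k l => wirtinger (fun u => gramMatrix γ u k l) z) 0 0 =
      (gramMatrix γ z).det⁻¹ * (gramMatrix γ z 1 1 * wirtinger (fun u => gramMatrix γ u 0 0) z -
        gramMatrix γ z 0 1 * wirtinger (fun u => gramMatrix γ u 1 0) z) := fun z => by
    simp [Matrix.inv_def, Matrix.adjugate_fin_two, Matrix.mul_apply, Fin.sum_univ_two]
    ring
  have e1 : ∀ z, ((gramMatrix γ z)⁻¹ *
      Matrix.of fun k l => wirtinger (fun u => gramMatrix γ u k l) z) 1 1 =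
      (gramMatrix γ z).det⁻¹ * (gramMatrix γ z 0 0 * wirtinger (fun u => gramMatrix γ u 1 1) z -
        gramMatrix γ z 1 0 * wirtinger (fun u => gramMatrix γ u 0 1) z) := fun z => by
    simp [Matrix.inv_def, Matrix.adjugate_fin_two, Matrix.mul_apply, Fin.sum_univ_two]
    ring
  simp only [curvatureMatrix, Matrix.trace, Matrix.diag_apply, Matrix.of_apply, Fin.sum_univ_two,
    e0, e1]
  rw [← neg_add, ← wirtingerBar_add, logCurv]
  · congr 1
    refine wirtingerBar_congr ?_
    filter_upwards [eventually_differentiableAt (hc 0 0),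
      eventually_differentiableAt (hc 0 1),
      eventually_differentiableAt (hc 1 0),
      eventually_differentiableAt (hc 1 1)] with z h00 h01 h10 h11
    have hw : wirtinger (fun z => (gramMatrix γ z).det) z =
        wirtinger (fun z => gramMatrix γ z 0 0 * gramMatrix γ z 1 1 -
          gramMatrix γ z 0 1 * gramMatrix γ z 1 0) z := by
      simp only [Matrix.det_fin_two]
    rw [hw, wirtinger_sub (h00.fun_mul h11) (h01.fun_mul h10), wirtinger_mul h00 h11,
      wirtinger_mul h01 h10]
    ring
  · exact hinv.fun_mul (((hd 1 1).fun_mul (hdw 0 0)).fun_sub ((hd 0 1).fun_mul (hdw 1 0)))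
  · exact hinv.fun_mul (((hd 0 0).fun_mul (hdw 1 1)).fun_sub ((hd 1 0).fun_mul (hdw 0 1)))

theorem IsFrameAt.lineCurvature_eq [CompleteSpace H] {γ : Fin 1 → ℂ → H}
    (hγ : IsFrameAt T w γ) :
    lineCurvature T w = -logCurv (fun z => (gramMatrix γ z).det) w := by
  have h : ∃ γ : Fin 1 → ℂ → H, IsFrameAt T w γ := ⟨γ, hγ⟩
  rw [lineCurvature, traceCurvature, dif_pos h, trace_curvatureMatrix_one,
    hγ.logCurv_eq h.choose_spec]

theorem IsFrameAt.traceCurvature_eq [CompleteSpace H] {γ : Fin 2 → ℂ → H}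
    (hγ : IsFrameAt T w γ) :
    traceCurvature 2 T w = -logCurv (fun z => (gramMatrix γ z).det) w := by
  have h : ∃ γ : Fin 2 → ℂ → H, IsFrameAt T w γ := ⟨γ, hγ⟩
  rw [traceCurvature, dif_pos h, trace_curvatureMatrix_two h.choose_spec,
    hγ.logCurv_eq h.choose_spec]

end Frames

/-! ### The trace condition -/

section Rigidity

variable {H₀ H₁ : Type*} [NormedAddCommGroup H₀] [InnerProductSpace ℂ H₀]
  [NormedAddCommGroup H₁] [InnerProductSpace ℂ H₁]
  {T₀ : H₀ →L[ℂ] H₀} {S S' : H₁ →L[ℂ] H₀} {T₁ : H₁ →L[ℂ] H₁} {Ω V : Set ℂ} {w : ℂ}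

theorem MemB.isFrameAt {H : Type*} [NormedAddCommGroup H] [InnerProductSpace ℂ H]
    {T : H →L[ℂ] H} (hT : MemB 1 Ω T) (hV : IsOpen V) (hVΩ : V ⊆ Ω) (hw : w ∈ V) {s : ℂ → H}
    (hs : DifferentiableOn ℂ s V) (hs0 : ∀ z ∈ V, s z ≠ 0) (hsT : ∀ z ∈ V, s z ∈ fibre T z) :
    IsFrameAt T w (fun _ : Fin 1 => s) := by
  refine ⟨V, hV, hw, fun _ => hs, fun z hz => ⟨?_, ?_⟩⟩
  · exact LinearIndependent.of_subsingleton (v := fun _ : Fin 1 => s z) 0 (hs0 z hz)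
  · rw [Set.range_const]
    refine le_antisymm ((Submodule.span_singleton_le_iff_mem _ _).2 (hsT z hz)) fun x hx => ?_
    obtain ⟨c, rfl⟩ := hT.exists_smul_eq (hVΩ hz) (hsT z hz) (hs0 z hz) hx
    exact Submodule.smul_mem _ _ (Submodule.mem_span_singleton_self _)

/-- Eigenvectors `(s, 0)` and `(x, t)` with `s` and `t` nonvanishing form a frame of the rank two
bundle. -/
theorem MemFB2.isFrameAt (hT : MemFB2 Ω T₀ S T₁) (hV : IsOpen V) (hVΩ : V ⊆ Ω) (hw : w ∈ V)
    {s x : ℂ → H₀} {t : ℂ → H₁} (hs : DifferentiableOn ℂ s V) (hx : DifferentiableOn ℂ x V)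
    (ht : DifferentiableOn ℂ t V) (hs0 : ∀ z ∈ V, s z ≠ 0) (ht0 : ∀ z ∈ V, t z ≠ 0)
    (hsT : ∀ z ∈ V, s z ∈ fibre T₀ z)
    (hxt : ∀ z ∈ V, inlL H₀ H₁ (x z) + inrL H₀ H₁ (t z) ∈ fibre (upperTriangular T₀ S T₁) z) :
    IsFrameAt (upperTriangular T₀ S T₁) w
      ![fun z => inlL H₀ H₁ (s z), fun z => inlL H₀ H₁ (x z) + inrL H₀ H₁ (t z)] := by
  have hl : DifferentiableOn ℂ (fun z => inlL H₀ H₁ (s z)) V :=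
    (inlL H₀ H₁).differentiable.comp_differentiableOn hs
  have hr : DifferentiableOn ℂ (fun z => inlL H₀ H₁ (x z) + inrL H₀ H₁ (t z)) V :=
    ((inlL H₀ H₁).differentiable.comp_differentiableOn hx).fun_add
      ((inrL H₀ H₁).differentiable.comp_differentiableOn ht)
  refine ⟨V, hV, hw, ?_, fun z hz => ?_⟩
  · rw [Fin.forall_fin_two]
    exact ⟨hl, hr⟩
  · have heq : (fun i => (![fun z => inlL H₀ H₁ (s z),
        fun z => inlL H₀ H₁ (x z) + inrL H₀ H₁ (t z)] : Fin 2 → ℂ → WithLp 2 (H₀ × H₁)) i z) =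
        ![inlL H₀ H₁ (s z), inlL H₀ H₁ (x z) + inrL H₀ H₁ (t z)] := by
      funext i
      fin_cases i <;> rfl
    rw [heq]
    have hs1 := mem_fibre.1 (hsT z hz)
    obtain ⟨hx1, hx2⟩ := mem_fibre_upperTriangular.1 (hxt z hz)
    simp only [WithLp.add_fst, WithLp.add_snd, inlL_fst, inlL_snd, inrL_fst, inrL_snd, add_zero,
      zero_add] at hx1 hx2
    constructor
    · rw [LinearIndependent.pair_iff]
      intro a b hab
      have h1 := congrArg WithLp.snd hab
      have h2 := congrArg WithLp.fst hab
      simp only [WithLp.add_fst, WithLp.add_snd, WithLp.smul_fst, WithLp.smul_snd, inlL_fst,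
        inlL_snd, inrL_fst, inrL_snd, add_zero, zero_add, smul_zero, WithLp.zero_fst,
        WithLp.zero_snd] at h1 h2
      have hb : b = 0 := (smul_eq_zero.1 h1).resolve_right (ht0 z hz)
      rw [hb, zero_smul, add_zero] at h2
      exact ⟨(smul_eq_zero.1 h2).resolve_right (hs0 z hz), hb⟩
    · rw [Matrix.range_cons_cons_empty]
      refine le_antisymm (Submodule.span_le.2 ?_) fun u hu => ?_
      · rintro _ (rfl | rfl)
        · rw [SetLike.mem_coe, mem_fibre_upperTriangular]
          simp [hs1]
        · exact hxt z hz
      · obtain ⟨hu1, hu2⟩ := mem_fibre_upperTriangular.1 hu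
        obtain ⟨β, hβ⟩ := hT.memB_right.exists_smul_eq (hVΩ hz) (mem_fibre.2 hx2) (ht0 z hz)
          (mem_fibre.2 hu2)
        have hdiff : u.fst - β • x z ∈ fibre T₀ z := by
          rw [mem_fibre, map_sub, map_smul, eq_sub_of_add_eq hu1, eq_sub_of_add_eq hx1, hβ,
            map_smul]
          module
        obtain ⟨α, hα⟩ := hT.memB_left.exists_smul_eq (hVΩ hz) (hsT z hz) (hs0 z hz) hdiff
        rw [Submodule.mem_span_pair]
        refine ⟨α, β, block_ext ?_ ?_⟩
        · simp [← hα]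
        · simp [hβ]

theorem det_gramMatrix_pair (s x : ℂ → H₀) (t : ℂ → H₁) (z : ℂ) :
    (gramMatrix ![fun z => inlL H₀ H₁ (s z), fun z => inlL H₀ H₁ (x z) + inrL H₀ H₁ (t z)] z).det =
      gramDet (s z) (x z) + inner ℂ (s z) (s z) * inner ℂ (t z) (t z) := by
  rw [Matrix.det_fin_two]
  simp [gramMatrix, gramDet, WithLp.prod_inner_apply]
  ring

/-- Differentiating `T σ(z) = z σ(z)` shows that `T σ' = σ + z σ'`. -/
theorem apply_deriv_of_mem_fibre {H : Type*} [NormedAddCommGroup H] [InnerProductSpace ℂ H]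
    {T : H →L[ℂ] H} (hV : IsOpen V) (hw : w ∈ V) {s : ℂ → H} (hs : DifferentiableOn ℂ s V)
    (hsT : ∀ z ∈ V, s z ∈ fibre T z) : T (deriv s w) = s w + w • deriv s w := by
  have hd : HasDerivAt s (deriv s w) w := (hs.differentiableAt (hV.mem_nhds hw)).hasDerivAt
  have h1 : HasDerivAt (fun z => T (s z)) (T (deriv s w)) w := T.hasFDerivAt.comp_hasDerivAt w hd
  have h2 : HasDerivAt (fun z => z • s z) (w • deriv s w + (1 : ℂ) • s w) w :=
    (hasDerivAt_id w).fun_smul hd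
  have h3 : (fun z => T (s z)) =ᶠ[𝓝 w] fun z => z • s z := by
    filter_upwards [hV.mem_nhds hw] with z hz
    exact mem_fibre.1 (hsT z hz)
  rw [(h1.congr_of_eventuallyEq h3.symm).unique h2, one_smul, add_comm]

variable [CompleteSpace H₀] [CompleteSpace H₁]

/-- There is a point of `Ω` off the unit circle over which `S` does not vanish. -/
theorem MemFB2.exists_map_ne_zero (hΩ : IsOpen Ω) (hΩc : IsConnected Ω) (hT : MemFB2 Ω T₀ S T₁) :
    ∃ w ∈ Ω, ‖w‖ ≠ 1 ∧ ∃ y ∈ fibre T₁ w, S y ≠ 0 := by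
  obtain ⟨v, hv, hv1⟩ : ∃ v ∈ Ω, ‖v‖ ≠ 1 := by
    by_contra! h
    have h1 : Ω ⊆ interior (Metric.sphere (0 : ℂ) 1) :=
      interior_maximal (fun z hz => by simpa using h z hz) hΩ
    rw [interior_sphere _ one_ne_zero] at h1
    exact h1 hΩc.nonempty.some_mem
  by_contra! h
  refine hT.ne_zero (hT.memB_right.eq_zero_of_eventually hΩc.isPreconnected S hv ?_)
  filter_upwards [hΩ.mem_nhds hv, continuous_norm.continuousAt.eventually_ne hv1] with z hz hz1
  exact h z hz hz1

/-- The trace condition forces `S'` to be a multiple of `S`. In the frame `(σ, 0), (-g σ', t)` with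
`σ = S t` and `S' t = g σ`, the Gram determinant is `‖σ‖² ‖t‖² (1 + r |g|²)` with the constant
`r > 0` provided by homogeneity. So `log (1 + r |g|²)` is harmonic, and `g` is constant. -/
theorem MemFB2.exists_eq_smul (hΩ : IsOpen Ω) (hΩc : IsConnected Ω)
    (hT : MemFB2 Ω T₀ S T₁) (hhom : IsHomogeneous (upperTriangular T₀ S T₁))
    (hT' : MemFB2 Ω T₀ S' T₁)
    (htr : ∀ w ∈ Ω, traceCurvature 2 (upperTriangular T₀ S' T₁) w =
      lineCurvature T₀ w + lineCurvature T₁ w) :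
    ∃ g : ℂ, g ≠ 0 ∧ S' = g • S := by
  obtain ⟨w, hw, hw1, y, hy, hSy⟩ := hT.exists_map_ne_zero hΩ hΩc
  obtain ⟨δ, hδ, t, htd, ht⟩ := hT.memB_right.exists_line_frame hw
  have hwδ : w ∈ Metric.ball w δ := Metric.mem_ball_self hδ
  have htT : ∀ z ∈ Metric.ball w δ, t z ∈ fibre T₁ z := fun z hz => by
    rw [(ht z hz).2]; exact Submodule.mem_span_singleton_self _
  let σ : ℂ → H₀ := fun z => S (t z)
  have hσw : σ w ≠ 0 := fun h => by
    rw [(ht w hwδ).2, Submodule.mem_span_singleton] at hy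
    obtain ⟨c, rfl⟩ := hy
    exact hSy (by rw [map_smul, show S (t w) = 0 from h, smul_zero])
  have hσd : DifferentiableOn ℂ σ (Metric.ball w δ) := S.differentiable.comp_differentiableOn htd
  have hσT : ∀ z ∈ Metric.ball w δ, σ z ∈ fibre T₀ z := fun z hz => hT.map_mem_fibre (htT z hz)
  have hσ' : ∀ z ∈ Metric.ball w δ, T₀ (deriv σ z) = σ z + z • deriv σ z := fun z hz =>
    apply_deriv_of_mem_fibre Metric.isOpen_ball hz hσd hσT
  have hmem : ∀ z ∈ Metric.ball w δ,
      inlL H₀ H₁ (-deriv σ z) + inrL H₀ H₁ (t z) ∈ fibre (upperTriangular T₀ S T₁) z := by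
    intro z hz
    rw [mem_fibre_upperTriangular]
    refine ⟨?_, by simpa using mem_fibre.1 (htT z hz)⟩
    simp [hσ' z hz, σ]
  -- The constant value of the ratio `gramDet σ σ' / (‖σ‖² ‖t‖²)` near `w`.
  obtain ⟨ρ, hρ, hρeq⟩ : ∃ ρ : ℝ, 0 < ρ ∧ gramDet (σ w) (-deriv σ w) = ρ := by
    refine exists_gramDet_eq_pos hσw fun c hc => hσw ?_
    have h1 := mem_fibre.1 (Submodule.smul_mem _ c (hσT w hwδ))
    have h2 := hσ' w hwδ
    rw [← hc, map_neg, h2] at h1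
    simpa using h1
  let r : ℝ := ρ / (‖σ w‖ ^ 2 * ‖t w‖ ^ 2)
  have htw : t w ≠ 0 := (ht w hwδ).1
  have hr : 0 < r := by
    have := norm_pos_iff.2 hσw
    have := norm_pos_iff.2 htw
    positivity
  have hconst := hT.eventually_gramDet_mul_eq hΩ hΩc.isPreconnected hhom hw hw1 (hσT w hwδ)
    (hmem w hwδ)
  have hσc : ContinuousAt σ w := hσd.continuousOn.continuousAt (Metric.isOpen_ball.mem_nhds hwδ)
  have hinner : ContinuousAt (fun z => inner ℂ (σ w) (σ z)) w :=
    (innerSL ℂ (σ w)).continuous.continuousAt.comp hσc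
  have hinner0 : inner ℂ (σ w) (σ w) ≠ 0 := inner_self_ne_zero.2 hσw
  obtain ⟨ε, hε, hB⟩ := Metric.eventually_nhds_iff_ball.1
    (((Metric.isOpen_ball.eventually_mem hwδ).and (hΩ.eventually_mem hw)).and
      ((hσc.eventually_ne hσw).and ((hinner.eventually_ne hinner0).and hconst)))
  set B := Metric.ball w ε
  have hBo : IsOpen B := Metric.isOpen_ball
  have hwB : w ∈ B := Metric.mem_ball_self hε
  have hBδ : B ⊆ Metric.ball w δ := fun z hz => (hB z hz).1.1
  have hBΩ : B ⊆ Ω := fun z hz => (hB z hz).1.2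
  have hσ0 : ∀ z ∈ B, σ z ≠ 0 := fun z hz => (hB z hz).2.1
  have ht0 : ∀ z ∈ B, t z ≠ 0 := fun z hz => (ht z (hBδ hz)).1
  have hσB := hσd.mono hBδ
  have htB := htd.mono hBδ
  have hratio : ∀ z ∈ B, gramDet (σ z) (deriv σ z) =
      r * (inner ℂ (σ z) (σ z) * inner ℂ (t z) (t z)) := by
    intro z hz
    have h1 := (hB z hz).2.2.2 _ (hσT z (hBδ hz)) (hσ0 z hz) _ (hmem z (hBδ hz))
      (by simpa using ht0 z hz)
    have h2 : gramDet (σ z) (-deriv σ z) = gramDet (σ z) (deriv σ z) := by simp [gramDet]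
    simp only [WithLp.add_fst, WithLp.add_snd, inlL_fst, inlL_snd, inrL_fst, inrL_snd, add_zero,
      zero_add, hρeq, h2] at h1
    have h3 : inner ℂ (σ w) (σ w) * inner ℂ (t w) (t w) ≠ 0 :=
      mul_ne_zero hinner0 (inner_self_ne_zero.2 htw)
    have h4 : (r : ℂ) = ρ / (inner ℂ (σ w) (σ w) * inner ℂ (t w) (t w)) := by
      simp only [r, inner_self_eq_norm_sq_to_K]
      push_cast
      rfl
    rw [h4, div_mul_eq_mul_div, eq_div_iff h3, h1]
  -- The holomorphic function `g` with `S' t = g σ`.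
  let g : ℂ → ℂ := fun z => inner ℂ (σ w) (S' (t z)) / inner ℂ (σ w) (σ z)
  have hgd : DifferentiableOn ℂ g B := by
    refine DifferentiableOn.fun_div ?_ ?_ fun z hz => (hB z hz).2.2.1
    · exact ((innerSL ℂ (σ w)) ∘L S').differentiable.comp_differentiableOn htB
    · exact (innerSL ℂ (σ w)).differentiable.comp_differentiableOn hσB
  have hg : ∀ z ∈ B, S' (t z) = g z • σ z := by
    intro z hz
    obtain ⟨c, hc⟩ := hT.memB_left.exists_smul_eq (hBΩ hz) (hσT z (hBδ hz)) (hσ0 z hz)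
      (hT'.map_mem_fibre (htT z (hBδ hz)))
    simp only [g, hc, inner_smul_right]
    rw [mul_div_cancel_right₀ _ (hB z hz).2.2.1]
  have hmem' : ∀ z ∈ B, inlL H₀ H₁ (-(g z • deriv σ z)) + inrL H₀ H₁ (t z) ∈
      fibre (upperTriangular T₀ S' T₁) z := by
    intro z hz
    rw [mem_fibre_upperTriangular]
    refine ⟨?_, by simpa using mem_fibre.1 (htT z (hBδ hz))⟩
    have h1 : T₀ (-(g z • deriv σ z)) + S' (t z) = z • -(g z • deriv σ z) := by
      rw [map_neg, map_smul, hσ' z (hBδ hz), hg z hz]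
      module
    simpa using h1
  have hxd : DifferentiableOn ℂ (fun z => -(g z • deriv σ z)) B :=
    (hgd.fun_smul (hσB.deriv hBo)).fun_neg
  have hderiv : Set.EqOn (deriv g) 0 B := by
    intro z hz
    have hfr := hT'.isFrameAt hBo hBΩ hz hσB hxd htB hσ0 ht0
      (fun z hz => hσT z (hBδ hz)) hmem'
    have hfr₀ := hT.memB_left.isFrameAt hBo hBΩ hz hσB hσ0 fun z hz => hσT z (hBδ hz)
    have hfr₁ := hT.memB_right.isFrameAt hBo hBΩ hz htB ht0 fun z hz => htT z (hBδ hz)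
    have hga : AnalyticAt ℂ g z := hgd.analyticAt (hBo.mem_nhds hz)
    have hgc : ContDiffAt ℝ 2 g z := hga.contDiffAt.restrict_scalars ℝ
    have hgc' : ContDiffAt ℝ 2 (fun z => conj (g z)) z :=
      Complex.conjCLE.contDiff.contDiffAt.comp z hgc
    have hdet : (fun z => (gramMatrix ![fun z => inlL H₀ H₁ (σ z),
        fun z => inlL H₀ H₁ (-(g z • deriv σ z)) + inrL H₀ H₁ (t z)] z).det) =ᶠ[𝓝 z] fun z =>
        (inner ℂ (σ z) (σ z) * inner ℂ (t z) (t z)) * (1 + r * (g z * conj (g z))) := by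
      filter_upwards [hBo.mem_nhds hz] with v hv
      have h1 : gramDet (σ v) (-(g v • deriv σ v)) =
          g v * conj (g v) * gramDet (σ v) (deriv σ v) := by
        have := gramDet_smul_add 1 (-g v) 0 (σ v) (deriv σ v)
        simpa using this
      rw [det_gramMatrix_pair, h1, hratio v hv]
      ring
    have hne : (1 : ℂ) + r * (g z * conj (g z)) ≠ 0 := by
      rw [Complex.mul_conj]
      have : (0 : ℝ) < 1 + r * Complex.normSq (g z) := by
        have := Complex.normSq_nonneg (g z)
        positivity
      exact_mod_cast this.ne'
    have hcσ := contDiffAt_inner hBo hz hσB hσB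
    have hct := contDiffAt_inner hBo hz htB htB
    have hσ1 : inner ℂ (σ z) (σ z) ≠ 0 := inner_self_ne_zero.2 (hσ0 z hz)
    have ht1 : inner ℂ (t z) (t z) ≠ 0 := inner_self_ne_zero.2 (ht0 z hz)
    have h := htr z (hBΩ hz)
    rw [hfr.traceCurvature_eq, hfr₀.lineCurvature_eq, hfr₁.lineCurvature_eq, logCurv_congr hdet,
      logCurv_mul (hcσ.mul hct) (contDiffAt_const.add (contDiffAt_const.mul (hgc.mul hgc')))
        (mul_ne_zero hσ1 ht1) hne, logCurv_mul hcσ hct hσ1 ht1, logCurv_one_add hga hr] at h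
    simp only [Matrix.det_fin_one, gramMatrix, Matrix.of_apply] at h
    have h5 : (r : ℂ) * (deriv g z * conj (deriv g z)) / (1 + r * (g z * conj (g z))) ^ 2 = 0 := by
      linear_combination -h
    have hr0 : (r : ℂ) ≠ 0 := by exact_mod_cast hr.ne'
    simpa [hr0, hne] using h5
  have hgconst : ∀ z ∈ B, g z = g w := fun z hz =>
    hBo.is_const_of_deriv_eq_zero (convex_ball w ε).isPreconnected hgd hderiv hz hwB
  have hS' : S' - g w • S = 0 := by
    refine hT.memB_right.eq_zero_of_eventually hΩc.isPreconnected _ hw ?_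
    filter_upwards [hBo.mem_nhds hwB] with z hz x hx
    rw [(ht z (hBδ hz)).2, Submodule.mem_span_singleton] at hx
    obtain ⟨c, rfl⟩ := hx
    rw [map_smul, sub_apply, smul_apply, hg z hz, hgconst z hz]
    simp [σ]
  have hS'' : S' = g w • S := sub_eq_zero.1 hS'
  exact ⟨g w, fun h => hT'.ne_zero (by rw [hS'', h, zero_smul]), hS''⟩

end Rigidity

end CowenDouglas

theorem proposition1p9
    {H₀ : Type*} [NormedAddCommGroup H₀] [InnerProductSpace ℂ H₀] [CompleteSpace H₀]
    {H₁ : Type*} [NormedAddCommGroup H₁] [InnerProductSpace ℂ H₁] [CompleteSpace H₁]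
    (Ω : Set ℂ) (hΩ_open : IsOpen Ω) (hΩ_conn : IsConnected Ω)
    (T₀ : H₀ →L[ℂ] H₀) (T₁ : H₁ →L[ℂ] H₁) (S S' : H₁ →L[ℂ] H₀)
    (hT : CowenDouglas.MemFB2 Ω T₀ S T₁)
    (hT_hom : CowenDouglas.IsHomogeneous (CowenDouglas.upperTriangular T₀ S T₁))
    (hT' : CowenDouglas.MemFB2 Ω T₀ S' T₁)
    (h_trace : ∀ w ∈ Ω,
      CowenDouglas.traceCurvature 2 (CowenDouglas.upperTriangular T₀ S' T₁) w =
        CowenDouglas.lineCurvature T₀ w + CowenDouglas.lineCurvature T₁ w) :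
    CowenDouglas.IsHomogeneous (CowenDouglas.upperTriangular T₀ S' T₁) ∧
      ∃ X₁ : H₁ ≃L[ℂ] H₁, ∀ x : WithLp 2 (H₀ × H₁),
        CowenDouglas.blockDiagonal (ContinuousLinearEquiv.refl ℂ H₀) X₁
            (CowenDouglas.upperTriangular T₀ S' T₁ x) =
          CowenDouglas.upperTriangular T₀ S T₁
            (CowenDouglas.blockDiagonal (ContinuousLinearEquiv.refl ℂ H₀) X₁ x) := by
  obtain ⟨g, hg, rfl⟩ := hT.exists_eq_smul hΩ_open hΩ_conn hT_hom hT' h_trace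
  refine ⟨hT.isHomogeneous_smul hΩ_open hΩ_conn.isPreconnected hT_hom hg,
    ContinuousLinearEquiv.smulLeft (R₁ := ℂ) (Units.mk0 g hg), fun x => ?_⟩
  refine CowenDouglas.block_ext ?_ ?_
  · change T₀ x.fst + (g • S) x.snd = T₀ x.fst + S (g • x.snd)
    simp
  · change g • T₁ x.snd = T₁ (g • x.snd)
    rw [map_smul]
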